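/- Let $\Sigma>0$, $M>0$, let $\pi=\mathcal N(0,\Sigma)$ be the target on $\mathbb R$ and let $\tilde\pi\propto\exp\big(-\tfrac{q^2}{2\Sigma}-\tfrac{p^2}{2M}\big)$ on $\mathbb R^2$. For a friction $\gamma>0$ let $$\mathcal L_\gamma=M^{-1}p\,\partial_q-\Sigma^{-1}q\,\partial_p-\gamma M^{-1}p\,\partial_p+\gamma\,\partial_p^2$$ be the generator of the underdamped Langevin dynamics with mass $M$. Let $\hat k\in\mathbb N$, $a_0,\dots,a_{\hat k}\in\mathbb R$ and $f(q)=\sum_{i=0}^{\hat k}a_iq^{2i+1}$. Then $\pi(f)=\int f\,d\pi=0$, and the following holds. (i) For every $\gamma>0$ the Poisson equation $-\mathcal L_\gamma\phi=f-\pi(f)$ has exactly one solution $\phi_\gamma$ (in the sense of distributions, up to $\tilde\pi$-null sets) in $L^2_0(\tilde\pi)=\{g\in L^2(\tilde\pi):\int g\,d\tilde\pi=0\}$. It is a polynomial $\phi_\gamma(q,p)=\sum_{i+j\le 2\hat k+1}c_{i,j}(\gamma)q^ip^j$ of total degree at most $2\hat k+1$; it solves the equation pointwise, and also for the closure in $L^2(\tilde\pi)$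 of $\mathcal L_\gamma$ on $C_c^\infty(\mathbb R^2)$. (ii) Every contribution $2c_{i,j}(\gamma)\int q^ip^j\,(f-\pi(f))\,d\tilde\pi$ to the asymptotic variance $$\sigma^2(\gamma)=2\int\phi_\gamma\,(f-\pi(f))\,d\tilde\pi$$ is $O(\gamma)$ as $\gamma\to0^+$; so is $\sigma^2(\gamma)$ itself. (iii) $\inf_{\gamma>0}\sigma^2(\gamma)=0$. -/

import Mathlib

open MeasureTheory ProbabilityTheory Filter Topology Asymptotics
open scoped NNReal ContDiff

/-- The invariant measure of the Langevin dynamics in phase space `(q, p)`: the density is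
proportional to `exp (-q² / (2 S) - p² / (2 m))`, where `S > 0` is the variance of the Gaussian
target `gaussianReal 0 S` of the position `q` and `m > 0` is the mass. -/
noncomputable def phaseMeasure (S m : ℝ≥0) : Measure (ℝ × ℝ) :=
  (gaussianReal 0 S).prod (gaussianReal 0 m)

/-- `∂h/∂q`. -/
noncomputable def dq (h : ℝ × ℝ → ℝ) (z : ℝ × ℝ) : ℝ := deriv (fun q => h (q, z.2)) z.1

/-- `∂h/∂p`. -/
noncomputable def dp (h : ℝ × ℝ → ℝ) (z : ℝ × ℝ) : ℝ := deriv (fun p => h (z.1, p)) z.2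

/-- The generator `𝓛 = m⁻¹ p ∂_q - S⁻¹ q ∂_p - γ m⁻¹ p ∂_p + γ ∂_p²` of the Langevin dynamics with
friction `γ`, as a differential operator. -/
noncomputable def langevinGen (S m : ℝ≥0) (γ : ℝ) (h : ℝ × ℝ → ℝ) (z : ℝ × ℝ) : ℝ :=
  (m : ℝ)⁻¹ * z.2 * dq h z - (S : ℝ)⁻¹ * z.1 * dp h z - γ * (m : ℝ)⁻¹ * z.2 * dp h z
    + γ * dp (dp h) z

/-- The formal adjoint of `langevinGen` in `L²(phaseMeasure S m)`. -/
noncomputable def langevinAdj (S m : ℝ≥0) (γ : ℝ) (h : ℝ × ℝ → ℝ) (z : ℝ × ℝ) : ℝ :=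
  -((m : ℝ)⁻¹ * z.2 * dq h z) + (S : ℝ)⁻¹ * z.1 * dp h z - γ * (m : ℝ)⁻¹ * z.2 * dp h z
    + γ * dp (dp h) z

/-- The centred observable `f - π(f)`, as a function on phase space. -/
noncomputable def centred (S : ℝ≥0) (f : ℝ → ℝ) (z : ℝ × ℝ) : ℝ :=
  f z.1 - ∫ q, f q ∂(gaussianReal 0 S)

/-- `φ ∈ L²₀(phaseMeasure S m)` solves the Poisson equation `-𝓛 φ = f - π(f)` in the sense of
distributions. -/
structure IsPoissonSolution (S m : ℝ≥0) (γ : ℝ) (f : ℝ → ℝ) (φ : ℝ × ℝ → ℝ) : Prop where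
  memLp : MemLp φ 2 (phaseMeasure S m)
  mean_zero : ∫ z, φ z ∂(phaseMeasure S m) = 0
  weak : ∀ h : ℝ × ℝ → ℝ, ContDiff ℝ ∞ h → HasCompactSupport h →
    -∫ z, φ z * langevinAdj S m γ h z ∂(phaseMeasure S m)
      = ∫ z, centred S f z * h z ∂(phaseMeasure S m)

/-- `φ` lies in the domain of the closure in `L²(phaseMeasure S m)` of the operator `𝓛` on smooth
compactly supported functions, and this closure maps `φ` to `-(f - π(f))`. Consequently
`-L φ = f - π(f)` for every closed operator `L` that extends `𝓛` from those functions, such as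
the generator of the Langevin semigroup. -/
def IsStrongPoissonSolution (S m : ℝ≥0) (γ : ℝ) (f : ℝ → ℝ) (φ : ℝ × ℝ → ℝ) : Prop :=
  MemLp φ 2 (phaseMeasure S m) ∧
  ∃ h : ℕ → ℝ × ℝ → ℝ, (∀ n, ContDiff ℝ ∞ (h n) ∧ HasCompactSupport (h n)) ∧
    Tendsto (fun n => eLpNorm (fun z => h n z - φ z) 2 (phaseMeasure S m)) atTop (𝓝 0) ∧
    Tendsto (fun n => eLpNorm (fun z => langevinGen S m γ (h n) z + centred S f z) 2
      (phaseMeasure S m)) atTop (𝓝 0)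

/-- The asymptotic variance `2 ∫ φ (f - π(f))` attached to a solution `φ` of the Poisson
equation. -/
noncomputable def asympVar (S m : ℝ≥0) (f : ℝ → ℝ) (φ : ℝ × ℝ → ℝ) : ℝ :=
  2 * ∫ z, φ z * centred S f z ∂(phaseMeasure S m)

/-- The odd polynomial `∑_{i=0}^{k} a_i q^{2i+1}`. -/
noncomputable def oddPoly (k : ℕ) (a : ℕ → ℝ) (q : ℝ) : ℝ :=
  ∑ i ∈ Finset.range (k + 1), a i * q ^ (2 * i + 1)

/-- The function on phase space given by a polynomial in the two variables `q` (index `0`) and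
`p` (index `1`). -/
noncomputable def polyFun (ψ : MvPolynomial (Fin 2) ℝ) (z : ℝ × ℝ) : ℝ :=
  MvPolynomial.eval ![z.1, z.2] ψ

/-- The contribution of the monomial with exponents `d` in `ψ` to the asymptotic variance. -/
noncomputable def contribution (S m : ℝ≥0) (f : ℝ → ℝ) (ψ : MvPolynomial (Fin 2) ℝ)
    (d : Fin 2 →₀ ℕ) : ℝ :=
  asympVar S m f (polyFun (MvPolynomial.monomial d (ψ.coeff d)))

/-! Write the generator as `A + γ B`, with `A` the Hamiltonian part, antisymmetric in `L²` of the
Gaussian, and `B` the friction part, whose quadratic form is `-∫ (∂_p u)²`. Neither part raises the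
degree of a polynomial, and both commute with `(q, p) ↦ (-q, -p)`. The Poisson equation is therefore
a linear system on the finite-dimensional space of odd polynomials of degree at most `2k + 1`, where
solvability follows from injectivity (`oddGen_bijective`). For `γ > 0` the energy identity leaves
only constants in the kernel. For `γ = 0` the flow of `A` is a harmonic oscillator, which reaches
`-z` from `z` after half a period, so an odd invariant vanishes.

Since `γ = 0` is included, the solutions satisfy `u_γ + γ A⁻¹ B u_γ = u_0`. They stay bounded as `γ
→ 0`, and every linear functional vanishing at `u_0` is `O(γ)` along them (`isBigO_of_add_smul_eq`).
Momentum reversal shows that `u_0` is odd in `p`: coefficients with an even power of `p` vanish in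
the limit, while those with an odd power are multiplied by a vanishing Gaussian moment. The variance
equals `2 γ ∫ (∂_p u_γ)²`, so it is nonnegative, and the same formula makes it zero at `u_0`; hence
it is `O(γ)` with infimum zero.

For uniqueness, the difference of two weak solutions is orthogonal to the adjoint applied to test
functions, hence, by cutoffs, to the adjoint applied to polynomials. Together with the constants
these images exhaust the polynomials (`exists_polyGen_add_C`), which are dense in `L²`
(`ae_eq_zero_of_forall_polyFun`). The same cutoffs show that the polynomial solution lies in the
domain of the closure. -/

/-! ### Functions of polynomial growth -/

/-- The weight `(1 + |q|) (1 + |p|)` measuring growth on phase space. -/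
noncomputable def phaseWeight (z : ℝ × ℝ) : ℝ := (1 + |z.1|) * (1 + |z.2|)

lemma one_le_phaseWeight (z : ℝ × ℝ) : 1 ≤ phaseWeight z := by
  unfold phaseWeight
  nlinarith [abs_nonneg z.1, abs_nonneg z.2, mul_nonneg (abs_nonneg z.1) (abs_nonneg z.2)]

/-- Continuous functions on phase space of at most polynomial growth. -/
def PolyGrowth (h : ℝ × ℝ → ℝ) : Prop :=
  Continuous h ∧ ∃ (C : ℝ) (n : ℕ), 0 ≤ C ∧ ∀ z, |h z| ≤ C * phaseWeight z ^ n

namespace PolyGrowth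

variable {g h : ℝ × ℝ → ℝ}

lemma const (c : ℝ) : PolyGrowth fun _ => c :=
  ⟨continuous_const, |c|, 0, abs_nonneg c, fun z => by simp⟩

lemma fst : PolyGrowth fun z => z.1 :=
  ⟨continuous_fst, 1, 1, zero_le_one, fun z => by
    simp only [phaseWeight, pow_one, one_mul]
    nlinarith [abs_nonneg z.1, abs_nonneg z.2, mul_nonneg (abs_nonneg z.1) (abs_nonneg z.2)]⟩

lemma snd : PolyGrowth fun z => z.2 :=
  ⟨continuous_snd, 1, 1, zero_le_one, fun z => by
    simp only [phaseWeight, pow_one, one_mul]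
    nlinarith [abs_nonneg z.1, abs_nonneg z.2, mul_nonneg (abs_nonneg z.1) (abs_nonneg z.2)]⟩

lemma add (hg : PolyGrowth g) (hh : PolyGrowth h) : PolyGrowth fun z => g z + h z := by
  obtain ⟨hgc, C, n, hC, hg⟩ := hg
  obtain ⟨hhc, D, k, hD, hh⟩ := hh
  refine ⟨hgc.add hhc, C + D, n + k, by positivity, fun z => ?_⟩
  have h1 := one_le_phaseWeight z
  have h2 : phaseWeight z ^ n ≤ phaseWeight z ^ (n + k) := pow_le_pow_right₀ h1 (by omega)
  have h3 : phaseWeight z ^ k ≤ phaseWeight z ^ (n + k) := pow_le_pow_right₀ h1 (by omega)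
  calc |g z + h z| ≤ |g z| + |h z| := abs_add_le _ _
    _ ≤ C * phaseWeight z ^ (n + k) + D * phaseWeight z ^ (n + k) := by
        gcongr
        · exact (hg z).trans (by gcongr)
        · exact (hh z).trans (by gcongr)
    _ = _ := by ring

lemma mul (hg : PolyGrowth g) (hh : PolyGrowth h) : PolyGrowth fun z => g z * h z := by
  obtain ⟨hgc, C, n, hC, hg⟩ := hg
  obtain ⟨hhc, D, k, hD, hh⟩ := hh
  refine ⟨hgc.mul hhc, C * D, n + k, by positivity, fun z => ?_⟩
  have h1 : 0 ≤ phaseWeight z := zero_le_one.trans (one_le_phaseWeight z)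
  calc |g z * h z| = |g z| * |h z| := abs_mul _ _
    _ ≤ (C * phaseWeight z ^ n) * (D * phaseWeight z ^ k) := by
        gcongr
        · exact hg z
        · exact hh z
    _ = _ := by ring

lemma const_mul (c : ℝ) (hh : PolyGrowth h) : PolyGrowth fun z => c * h z := (const c).mul hh

lemma neg (hh : PolyGrowth h) : PolyGrowth fun z => -h z := by
  simpa using hh.const_mul (-1)

lemma sub (hg : PolyGrowth g) (hh : PolyGrowth h) : PolyGrowth fun z => g z - h z := by
  simpa [sub_eq_add_neg] using hg.add hh.neg

lemma abs (hh : PolyGrowth h) : PolyGrowth fun z => |h z| := by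
  obtain ⟨hhc, D, k, hD, hh⟩ := hh
  exact ⟨hhc.abs, D, k, hD, fun z => by simpa using hh z⟩

lemma of_hasCompactSupport (hc : Continuous h) (hs : HasCompactSupport h) : PolyGrowth h := by
  obtain ⟨C, hC⟩ := hs.exists_bound_of_continuous hc
  exact ⟨hc, C, 0, (norm_nonneg _).trans (hC 0), fun z => by simpa using hC z⟩

lemma integrable_one_add_abs_pow (v : ℝ≥0) (n : ℕ) :
    Integrable (fun x : ℝ => (1 + |x|) ^ n) (gaussianReal 0 v) := by
  have h0 : MemLp (fun x : ℝ => |x|) n (gaussianReal 0 v) :=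
    (memLp_id_gaussianReal' (μ := 0) (v := v) n (ENNReal.natCast_ne_top n)).norm
  have h1 : MemLp (fun x : ℝ => 1 + |x|) n (gaussianReal 0 v) :=
    (memLp_const (1 : ℝ)).add h0
  have h2 := h1.integrable_norm_pow'
  refine h2.congr (Eventually.of_forall fun x => ?_)
  simp only [Real.norm_eq_abs]
  rw [abs_of_nonneg (by positivity)]

/-- The product form of the weight reduces the claim to Gaussian moments in each variable
separately. -/
lemma integrable (hh : PolyGrowth h) (S m : ℝ≥0) : Integrable h (phaseMeasure S m) := by
  obtain ⟨hc, C, n, hC, hh⟩ := hh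
  have := ((integrable_one_add_abs_pow S n).mul_prod (integrable_one_add_abs_pow m n)).const_mul C
  refine this.mono' hc.aestronglyMeasurable (Eventually.of_forall fun z => ?_)
  simpa [phaseWeight, mul_pow] using hh z

lemma memLp_two (hh : PolyGrowth h) (S m : ℝ≥0) : MemLp h 2 (phaseMeasure S m) := by
  rw [memLp_two_iff_integrable_sq hh.1.aestronglyMeasurable]
  simpa [sq] using (hh.mul hh).integrable S m

end PolyGrowth

instance (S m : ℝ≥0) : IsProbabilityMeasure (phaseMeasure S m) := by
  unfold phaseMeasure; infer_instance

/-! ### Gaussian integration by parts -/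

lemma hasDerivAt_gaussianPDFReal (v : ℝ≥0) (x : ℝ) :
    HasDerivAt (gaussianPDFReal 0 v) (-((v : ℝ)⁻¹ * x) * gaussianPDFReal 0 v x) x := by
  have h : HasDerivAt (fun x : ℝ => -(x - 0) ^ 2 / (2 * (v : ℝ))) (-((v : ℝ)⁻¹ * x)) x := by
    refine ((((hasDerivAt_id x).sub_const 0).pow 2).neg.div_const (2 * (v : ℝ))).congr_deriv ?_
    -- For `v = 0` both sides vanish by the convention for division by zero.
    by_cases hv : (v : ℝ) = 0
    · simp [hv]
    · simp only [id, sub_zero]; field_simp; simp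
  rw [gaussianPDFReal_def]
  refine (h.exp.const_mul ((√(2 * Real.pi * v))⁻¹)).congr_deriv ?_
  ring

/-- Integration by parts for the one-dimensional centred Gaussian. -/
lemma integral_deriv_gaussianReal {v : ℝ≥0} (hv : v ≠ 0) {g g' : ℝ → ℝ}
    (hg : ∀ x, HasDerivAt g (g' x) x) (hi : Integrable g (gaussianReal 0 v))
    (hi' : Integrable g' (gaussianReal 0 v))
    (hix : Integrable (fun x => x * g x) (gaussianReal 0 v)) :
    ∫ x, g' x ∂(gaussianReal 0 v) = (v : ℝ)⁻¹ * ∫ x, x * g x ∂(gaussianReal 0 v) := by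
  have key : ∀ u : ℝ → ℝ, Integrable u (gaussianReal 0 v) →
      Integrable fun x => gaussianPDFReal 0 v x * u x := by
    intro u hu
    rw [gaussianReal_of_var_ne_zero _ hv, integrable_withDensity_iff_integrable_smul'
      (measurable_gaussianPDF 0 v) (Eventually.of_forall fun x => gaussianPDF_lt_top)] at hu
    simpa using hu
  have h0 := integral_eq_zero_of_hasDerivAt_of_integrable
    (f := fun x => gaussianPDFReal 0 v x * g x)
    (f' := fun x => gaussianPDFReal 0 v x * (g' x - (v : ℝ)⁻¹ * (x * g x)))
    (fun x => ((hasDerivAt_gaussianPDFReal v x).mul (hg x)).congr_deriv (by ring))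
    (key _ (hi'.sub (hix.const_mul _))) (key _ hi)
  have h1 := integral_gaussianReal_eq_integral_smul (μ := 0) (v := v)
    (f := fun x => g' x - (v : ℝ)⁻¹ * (x * g x)) hv
  simp only [smul_eq_mul] at h1
  rw [h0, integral_sub hi' (hix.const_mul _), integral_const_mul] at h1
  linarith

lemma integral_fst_deriv_phaseMeasure {S : ℝ≥0} (hS : S ≠ 0) (m : ℝ≥0) {u u' : ℝ × ℝ → ℝ}
    (hu : ∀ z, HasDerivAt (fun q => u (q, z.2)) (u' z) z.1) (hg : PolyGrowth u)
    (hg' : PolyGrowth u') :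
    ∫ z, u' z ∂(phaseMeasure S m) = (S : ℝ)⁻¹ * ∫ z, z.1 * u z ∂(phaseMeasure S m) := by
  have i1 := hg.integrable S m
  have i2 := hg'.integrable S m
  have i3 := (PolyGrowth.fst.mul hg).integrable S m
  unfold phaseMeasure at *
  rw [integral_prod_symm _ i2, integral_prod_symm _ i3, ← integral_const_mul]
  refine integral_congr_ae ?_
  filter_upwards [i1.prod_left_ae, i2.prod_left_ae, i3.prod_left_ae] with p h1 h2 h3
  exact integral_deriv_gaussianReal hS (fun q => hu (q, p)) h1 h2 h3

lemma integral_snd_deriv_phaseMeasure (S : ℝ≥0) {m : ℝ≥0} (hm : m ≠ 0) {u u' : ℝ × ℝ → ℝ}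
    (hu : ∀ z, HasDerivAt (fun p => u (z.1, p)) (u' z) z.2) (hg : PolyGrowth u)
    (hg' : PolyGrowth u') :
    ∫ z, u' z ∂(phaseMeasure S m) = (m : ℝ)⁻¹ * ∫ z, z.2 * u z ∂(phaseMeasure S m) := by
  have i1 := hg.integrable S m
  have i2 := hg'.integrable S m
  have i3 := (PolyGrowth.snd.mul hg).integrable S m
  unfold phaseMeasure at *
  rw [integral_prod _ i2, integral_prod _ i3, ← integral_const_mul]
  refine integral_congr_ae ?_
  filter_upwards [i1.prod_right_ae, i2.prod_right_ae, i3.prod_right_ae] with q h1 h2 h3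
  exact integral_deriv_gaussianReal hm (fun p => hu (q, p)) h1 h2 h3

/-! ### The generator and its formal adjoint -/

/-- The Langevin generator with its Hamiltonian part multiplied by `s`: the generator itself
for `s = 1`, its formal adjoint for `s = -1`. -/
noncomputable def signedGen (S m : ℝ≥0) (s γ : ℝ) (h : ℝ × ℝ → ℝ) (z : ℝ × ℝ) : ℝ :=
  s * ((m : ℝ)⁻¹ * z.2 * dq h z - (S : ℝ)⁻¹ * z.1 * dp h z) - γ * (m : ℝ)⁻¹ * z.2 * dp h z
    + γ * dp (dp h) z

lemma signedGen_one (S m : ℝ≥0) (γ : ℝ) (h : ℝ × ℝ → ℝ) :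
    signedGen S m 1 γ h = langevinGen S m γ h := by
  ext z; simp only [signedGen, langevinGen]; ring

lemma signedGen_neg_one (S m : ℝ≥0) (γ : ℝ) (h : ℝ × ℝ → ℝ) :
    signedGen S m (-1) γ h = langevinAdj S m γ h := by
  ext z; simp only [signedGen, langevinAdj]; ring

lemma hasDerivAt_dq {h : ℝ × ℝ → ℝ} (hh : Differentiable ℝ h) (z : ℝ × ℝ) :
    HasDerivAt (fun q => h (q, z.2)) (dq h z) z.1 := by
  have : DifferentiableAt ℝ (fun q => h (q, z.2)) z.1 := by fun_prop
  exact this.hasDerivAt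

lemma hasDerivAt_dp {h : ℝ × ℝ → ℝ} (hh : Differentiable ℝ h) (z : ℝ × ℝ) :
    HasDerivAt (fun p => h (z.1, p)) (dp h z) z.2 := by
  have : DifferentiableAt ℝ (fun p => h (z.1, p)) z.2 := by fun_prop
  exact this.hasDerivAt

lemma dq_eq_fderiv {h : ℝ × ℝ → ℝ} (hh : Differentiable ℝ h) :
    dq h = fun z => fderiv ℝ h z (1, 0) := by
  ext z
  have := (hh z).hasFDerivAt.comp_hasDerivAt_of_eq z.1
    ((hasDerivAt_id z.1).prodMk (hasDerivAt_const z.1 z.2)) rfl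
  exact (hasDerivAt_dq hh z).unique this

lemma dp_eq_fderiv {h : ℝ × ℝ → ℝ} (hh : Differentiable ℝ h) :
    dp h = fun z => fderiv ℝ h z (0, 1) := by
  ext z
  have := (hh z).hasFDerivAt.comp_hasDerivAt_of_eq z.2
    ((hasDerivAt_const z.2 z.1).prodMk (hasDerivAt_id z.2)) rfl
  exact (hasDerivAt_dp hh z).unique this

lemma contDiff_dq {h : ℝ × ℝ → ℝ} (hh : ContDiff ℝ ∞ h) : ContDiff ℝ ∞ (dq h) := by
  rw [dq_eq_fderiv (hh.differentiable (by simp))]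
  exact (hh.fderiv_right (by simp)).clm_apply contDiff_const

lemma contDiff_dp {h : ℝ × ℝ → ℝ} (hh : ContDiff ℝ ∞ h) : ContDiff ℝ ∞ (dp h) := by
  rw [dp_eq_fderiv (hh.differentiable (by simp))]
  exact (hh.fderiv_right (by simp)).clm_apply contDiff_const

lemma hasCompactSupport_dq {h : ℝ × ℝ → ℝ} (hh : Differentiable ℝ h) (hs : HasCompactSupport h) :
    HasCompactSupport (dq h) := by
  rw [dq_eq_fderiv hh]; exact hs.fderiv_apply ℝ _

lemma hasCompactSupport_dp {h : ℝ × ℝ → ℝ} (hh : Differentiable ℝ h) (hs : HasCompactSupport h) :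
    HasCompactSupport (dp h) := by
  rw [dp_eq_fderiv hh]; exact hs.fderiv_apply ℝ _

/-- Smooth functions on phase space which have polynomial growth together with the derivatives
that occur in the generator. -/
structure SmoothGrowth (u : ℝ × ℝ → ℝ) : Prop where
  contDiff : ContDiff ℝ ∞ u
  self : PolyGrowth u
  dq : PolyGrowth (dq u)
  dp : PolyGrowth (dp u)
  dpp : PolyGrowth (_root_.dp (_root_.dp u))

namespace SmoothGrowth

variable {u v : ℝ × ℝ → ℝ}

lemma of_hasCompactSupport (hu : ContDiff ℝ ∞ u) (hs : HasCompactSupport u) : SmoothGrowth u where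
  contDiff := hu
  self := .of_hasCompactSupport hu.continuous hs
  dq := .of_hasCompactSupport (contDiff_dq hu).continuous
    (hasCompactSupport_dq (hu.differentiable (by simp)) hs)
  dp := .of_hasCompactSupport (contDiff_dp hu).continuous
    (hasCompactSupport_dp (hu.differentiable (by simp)) hs)
  dpp := .of_hasCompactSupport (contDiff_dp (contDiff_dp hu)).continuous
    (hasCompactSupport_dp ((contDiff_dp hu).differentiable (by simp))
      (hasCompactSupport_dp (hu.differentiable (by simp)) hs))

lemma signedGen (hu : SmoothGrowth u) (S m : ℝ≥0) (s γ : ℝ) :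
    PolyGrowth (signedGen S m s γ u) := by
  have h1 := ((PolyGrowth.snd.const_mul (m : ℝ)⁻¹).mul hu.dq).sub
    ((PolyGrowth.fst.const_mul (S : ℝ)⁻¹).mul hu.dp)
  have h2 := (PolyGrowth.snd.const_mul (γ * (m : ℝ)⁻¹)).mul hu.dp
  exact ((h1.const_mul s).sub h2).add (hu.dpp.const_mul γ)

/-- The Hamiltonian part of the generator is antisymmetric. -/
lemma integral_mul_hamiltonian (hu : SmoothGrowth u) (hv : SmoothGrowth v) {S m : ℝ≥0}
    (hS : S ≠ 0) (hm : m ≠ 0) :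
    ∫ z, v z * _root_.signedGen S m 1 0 u z ∂(phaseMeasure S m)
      = -∫ z, u z * _root_.signedGen S m 1 0 v z ∂(phaseMeasure S m) := by
  have hud := hu.contDiff.differentiable (by simp)
  have hvd := hv.contDiff.differentiable (by simp)
  have gq : PolyGrowth fun z => z.2 * (_root_.dq u z * v z + u z * _root_.dq v z) :=
    PolyGrowth.snd.mul ((hu.dq.mul hv.self).add (hu.self.mul hv.dq))
  have gp : PolyGrowth fun z => z.1 * (_root_.dp u z * v z + u z * _root_.dp v z) :=
    PolyGrowth.fst.mul ((hu.dp.mul hv.self).add (hu.self.mul hv.dp))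
  -- Weighted by `m⁻¹` and `S⁻¹` respectively, `e1` and `e2` both yield `S⁻¹ m⁻¹ ∫ q p u v`, and
  -- these cancel.
  have e1 := integral_fst_deriv_phaseMeasure hS m (u := fun z => z.2 * (u z * v z))
    (fun z => ((hasDerivAt_dq hud z).mul (hasDerivAt_dq hvd z)).const_mul z.2)
    (PolyGrowth.snd.mul (hu.self.mul hv.self)) gq
  have e2 := integral_snd_deriv_phaseMeasure S hm (u := fun z => z.1 * (u z * v z))
    (fun z => ((hasDerivAt_dp hud z).mul (hasDerivAt_dp hvd z)).const_mul z.1)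
    (PolyGrowth.fst.mul (hu.self.mul hv.self)) gp
  rw [eq_neg_iff_add_eq_zero, ← integral_add ((hv.self.mul (hu.signedGen S m 1 0)).integrable S m)
    ((hu.self.mul (hv.signedGen S m 1 0)).integrable S m)]
  have e3 : ∀ z : ℝ × ℝ, v z * _root_.signedGen S m 1 0 u z + u z * _root_.signedGen S m 1 0 v z
      = (m : ℝ)⁻¹ * (z.2 * (_root_.dq u z * v z + u z * _root_.dq v z))
        - (S : ℝ)⁻¹ * (z.1 * (_root_.dp u z * v z + u z * _root_.dp v z)) := by
    intro z; simp only [_root_.signedGen]; ring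
  simp_rw [e3]
  rw [integral_sub ((gq.const_mul _).integrable S m) ((gp.const_mul _).integrable S m),
    integral_const_mul, integral_const_mul, e1, e2]
  have e4 : ∀ z : ℝ × ℝ, z.1 * (z.2 * (u z * v z)) = z.2 * (z.1 * (u z * v z)) := fun z => by ring
  simp_rw [e4]; ring

/-- The dissipative part of the generator is a Dirichlet form. -/
lemma integral_mul_dissipation (hu : SmoothGrowth u) (hv : SmoothGrowth v) (S : ℝ≥0) {m : ℝ≥0}
    (hm : m ≠ 0) :
    ∫ z, v z * _root_.signedGen S m 0 1 u z ∂(phaseMeasure S m)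
      = -∫ z, _root_.dp u z * _root_.dp v z ∂(phaseMeasure S m) := by
  have hud := (contDiff_dp hu.contDiff).differentiable (by simp)
  have hvd := hv.contDiff.differentiable (by simp)
  have e2 := integral_snd_deriv_phaseMeasure S hm (u := fun z => _root_.dp u z * v z)
    (fun z => ((hasDerivAt_dp hud z).mul (hasDerivAt_dp hvd z)))
    (hu.dp.mul hv.self) ((hu.dpp.mul hv.self).add (hu.dp.mul hv.dp))
  rw [integral_add ((hu.dpp.mul hv.self).integrable S m) ((hu.dp.mul hv.dp).integrable S m)] at e2
  have e3 : ∀ z : ℝ × ℝ, v z * _root_.signedGen S m 0 1 u z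
      = _root_.dp (_root_.dp u) z * v z - (m : ℝ)⁻¹ * (z.2 * (_root_.dp u z * v z)) := by
    intro z; simp only [_root_.signedGen]; ring
  simp_rw [e3]
  rw [integral_sub ((hu.dpp.mul hv.self).integrable S m)
    (((PolyGrowth.snd.mul (hu.dp.mul hv.self)).const_mul _).integrable S m), integral_const_mul]
  linarith

lemma integral_mul_signedGen (hu : SmoothGrowth u) (hv : SmoothGrowth v) (S m : ℝ≥0) (s γ : ℝ) :
    ∫ z, v z * _root_.signedGen S m s γ u z ∂(phaseMeasure S m)
      = s * (∫ z, v z * _root_.signedGen S m 1 0 u z ∂(phaseMeasure S m))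
        + γ * ∫ z, v z * _root_.signedGen S m 0 1 u z ∂(phaseMeasure S m) := by
  rw [← integral_const_mul, ← integral_const_mul, ← integral_add
    (((hv.self.mul (hu.signedGen S m 1 0)).const_mul _).integrable S m)
    (((hv.self.mul (hu.signedGen S m 0 1)).const_mul _).integrable S m)]
  congr 1; ext z; simp only [_root_.signedGen]; ring

/-- `signedGen S m (-s) γ` is the formal adjoint of `signedGen S m s γ`. -/
lemma integral_mul_signedGen_comm (hu : SmoothGrowth u) (hv : SmoothGrowth v) {S m : ℝ≥0}
    (hS : S ≠ 0) (hm : m ≠ 0) (s γ : ℝ) :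
    ∫ z, v z * _root_.signedGen S m s γ u z ∂(phaseMeasure S m)
      = ∫ z, u z * _root_.signedGen S m (-s) γ v z ∂(phaseMeasure S m) := by
  rw [hu.integral_mul_signedGen hv, hv.integral_mul_signedGen hu,
    hu.integral_mul_hamiltonian hv hS hm, hu.integral_mul_dissipation hv S hm,
    hv.integral_mul_dissipation hu S hm]
  simp_rw [mul_comm (_root_.dp u _)]; ring

/-- The energy identity. -/
lemma integral_self_mul_signedGen (hu : SmoothGrowth u) {S m : ℝ≥0} (hS : S ≠ 0) (hm : m ≠ 0)
    (s γ : ℝ) :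
    ∫ z, u z * _root_.signedGen S m s γ u z ∂(phaseMeasure S m)
      = -(γ * ∫ z, _root_.dp u z ^ 2 ∂(phaseMeasure S m)) := by
  have h := hu.integral_mul_hamiltonian hu hS hm
  rw [hu.integral_mul_signedGen hu, hu.integral_mul_dissipation hu S hm]
  simp_rw [sq]
  rw [show ∫ z, u z * _root_.signedGen S m 1 0 u z ∂(phaseMeasure S m) = 0 by linarith]; ring

end SmoothGrowth

/-! ### Polynomials on phase space -/

section PolyFun

open MvPolynomial

@[simp] lemma polyFun_C (c : ℝ) (z : ℝ × ℝ) : polyFun (C c) z = c := by simp [polyFun]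

@[simp] lemma polyFun_add (ψ χ : MvPolynomial (Fin 2) ℝ) (z : ℝ × ℝ) :
    polyFun (ψ + χ) z = polyFun ψ z + polyFun χ z := by simp [polyFun]

@[simp] lemma polyFun_sub (ψ χ : MvPolynomial (Fin 2) ℝ) (z : ℝ × ℝ) :
    polyFun (ψ - χ) z = polyFun ψ z - polyFun χ z := by simp [polyFun]

@[simp] lemma polyFun_neg (ψ : MvPolynomial (Fin 2) ℝ) (z : ℝ × ℝ) :
    polyFun (-ψ) z = -polyFun ψ z := by simp [polyFun]

@[simp] lemma polyFun_mul (ψ χ : MvPolynomial (Fin 2) ℝ) (z : ℝ × ℝ) :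
    polyFun (ψ * χ) z = polyFun ψ z * polyFun χ z := by simp [polyFun]

@[simp] lemma polyFun_pow (ψ : MvPolynomial (Fin 2) ℝ) (n : ℕ) (z : ℝ × ℝ) :
    polyFun (ψ ^ n) z = polyFun ψ z ^ n := by simp [polyFun]

@[simp] lemma polyFun_smul (c : ℝ) (ψ : MvPolynomial (Fin 2) ℝ) (z : ℝ × ℝ) :
    polyFun (c • ψ) z = c * polyFun ψ z := by simp [polyFun]

@[simp] lemma polyFun_X_zero (z : ℝ × ℝ) : polyFun (X 0) z = z.1 := by simp [polyFun]

@[simp] lemma polyFun_X_one (z : ℝ × ℝ) : polyFun (X 1) z = z.2 := by simp [polyFun]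

lemma polyFun_injective : Function.Injective polyFun := by
  intro ψ χ h
  refine MvPolynomial.funext fun x => ?_
  have := congrFun h (x 0, x 1)
  have hx : ![x 0, x 1] = x := by ext i; fin_cases i <;> rfl
  simpa [polyFun, hx] using this

lemma polyGrowth_polyFun (ψ : MvPolynomial (Fin 2) ℝ) : PolyGrowth (polyFun ψ) := by
  induction ψ using MvPolynomial.induction_on with
  | C c => exact (funext (polyFun_C c)) ▸ PolyGrowth.const c
  | add ψ χ h1 h2 => exact (funext (polyFun_add ψ χ)) ▸ h1.add h2
  | mul_X ψ i h =>
    rw [funext (polyFun_mul ψ (X i))]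
    fin_cases i
    · simpa using h.mul PolyGrowth.fst
    · simpa using h.mul PolyGrowth.snd

/-- The chain rule along a curve in phase space. -/
lemma hasDerivAt_polyFun_curve (ψ : MvPolynomial (Fin 2) ℝ) {x y : ℝ → ℝ} {x' y' t : ℝ}
    (hx : HasDerivAt x x' t) (hy : HasDerivAt y y' t) :
    HasDerivAt (fun t => polyFun ψ (x t, y t))
      (polyFun (pderiv 0 ψ) (x t, y t) * x' + polyFun (pderiv 1 ψ) (x t, y t) * y') t := by
  induction ψ using MvPolynomial.induction_on with
  | C c => simpa [polyFun] using hasDerivAt_const t c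
  | add ψ χ h1 h2 =>
    simp only [polyFun_add, map_add]
    exact (h1.add h2).congr_deriv (by ring)
  | mul_X ψ i h =>
    simp only [polyFun_mul, pderiv_mul, polyFun_add]
    fin_cases i
    · simp only [Fin.zero_eta, polyFun_X_zero, pderiv_X_self, Fin.isValue,
        pderiv_X_of_ne (show (0 : Fin 2) ≠ 1 by decide)]
      exact (h.mul hx).congr_deriv (by simp [polyFun]; ring)
    · simp only [Fin.mk_one, polyFun_X_one, pderiv_X_self, Fin.isValue,
        pderiv_X_of_ne (show (1 : Fin 2) ≠ 0 by decide)]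
      exact (h.mul hy).congr_deriv (by simp [polyFun]; ring)

lemma dq_polyFun (ψ : MvPolynomial (Fin 2) ℝ) : dq (polyFun ψ) = polyFun (pderiv 0 ψ) := by
  ext z
  have := hasDerivAt_polyFun_curve ψ (hasDerivAt_id z.1) (hasDerivAt_const z.1 z.2)
  simpa using! this.deriv

lemma dp_polyFun (ψ : MvPolynomial (Fin 2) ℝ) : dp (polyFun ψ) = polyFun (pderiv 1 ψ) := by
  ext z
  have := hasDerivAt_polyFun_curve ψ (hasDerivAt_const z.2 z.1) (hasDerivAt_id z.2)
  simpa using! this.deriv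

lemma contDiff_polyFun (ψ : MvPolynomial (Fin 2) ℝ) : ContDiff ℝ ∞ (polyFun ψ) := by
  induction ψ using MvPolynomial.induction_on with
  | C c => exact (funext (polyFun_C c)) ▸ contDiff_const
  | add ψ χ h1 h2 => exact (funext (polyFun_add ψ χ)) ▸ h1.add h2
  | mul_X ψ i h =>
    rw [funext (polyFun_mul ψ (X i))]
    fin_cases i
    · simpa using h.mul contDiff_fst
    · simpa using h.mul contDiff_snd

lemma smoothGrowth_polyFun (ψ : MvPolynomial (Fin 2) ℝ) : SmoothGrowth (polyFun ψ) where
  contDiff := contDiff_polyFun ψ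
  self := polyGrowth_polyFun ψ
  dq := dq_polyFun ψ ▸ polyGrowth_polyFun _
  dp := dp_polyFun ψ ▸ polyGrowth_polyFun _
  dpp := dp_polyFun ψ ▸ dp_polyFun (pderiv 1 ψ) ▸ polyGrowth_polyFun _

/-- By the chain rule the polynomial is constant along every line through the origin. -/
lemma eq_C_of_pderiv_eq_zero {ψ : MvPolynomial (Fin 2) ℝ} (h0 : pderiv 0 ψ = 0)
    (h1 : pderiv 1 ψ = 0) : ψ = C (polyFun ψ 0) := by
  apply polyFun_injective
  ext z
  rw [polyFun_C]
  have hd : ∀ t : ℝ, HasDerivAt (fun t => polyFun ψ (t * z.1, t * z.2)) 0 t := fun t => by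
    refine (hasDerivAt_polyFun_curve ψ ((hasDerivAt_id t).mul_const z.1)
      ((hasDerivAt_id t).mul_const z.2)).congr_deriv ?_
    simp [h0, h1, polyFun]
  have := is_const_of_deriv_eq_zero (fun t => (hd t).differentiableAt) (fun t => (hd t).deriv) 1 0
  simpa [Prod.zero_eq_mk] using this

/-- The action of `signedGen` on polynomials. -/
noncomputable def polyGen (S m : ℝ≥0) (s γ : ℝ) :
    MvPolynomial (Fin 2) ℝ →ₗ[ℝ] MvPolynomial (Fin 2) ℝ where
  toFun ψ := s • ((m : ℝ)⁻¹ • (X 1 * pderiv 0 ψ) - (S : ℝ)⁻¹ • (X 0 * pderiv 1 ψ))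
    - (γ * (m : ℝ)⁻¹) • (X 1 * pderiv 1 ψ) + γ • pderiv 1 (pderiv 1 ψ)
  map_add' ψ χ := by simp only [map_add, mul_add, smul_add, smul_sub]; abel
  map_smul' c ψ := by
    simp only [Derivation.map_smul, mul_smul_comm, smul_add, smul_sub, RingHom.id_apply, smul_smul]
    ring_nf

lemma polyGen_apply (S m : ℝ≥0) (s γ : ℝ) (ψ : MvPolynomial (Fin 2) ℝ) :
    polyGen S m s γ ψ = s • ((m : ℝ)⁻¹ • (X 1 * pderiv 0 ψ) - (S : ℝ)⁻¹ • (X 0 * pderiv 1 ψ))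
      - (γ * (m : ℝ)⁻¹) • (X 1 * pderiv 1 ψ) + γ • pderiv 1 (pderiv 1 ψ) := rfl

lemma polyFun_polyGen (S m : ℝ≥0) (s γ : ℝ) (ψ : MvPolynomial (Fin 2) ℝ) :
    polyFun (polyGen S m s γ ψ) = signedGen S m s γ (polyFun ψ) := by
  ext z
  simp only [polyGen_apply, signedGen, dq_polyFun, dp_polyFun, polyFun_add, polyFun_sub,
    polyFun_smul, polyFun_mul, polyFun_X_zero, polyFun_X_one]
  ring

/-- The strict drop pays for the factor `X j` in the generator. It fails for constants, since the
zero polynomial has degree `0` by convention. -/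
lemma totalDegree_pderiv_lt (i : Fin 2) {ψ : MvPolynomial (Fin 2) ℝ} (h : pderiv i ψ ≠ 0) :
    (pderiv i ψ).totalDegree + 1 ≤ ψ.totalDegree := by
  obtain ⟨d, hd, he⟩ := Finset.exists_mem_eq_sup _ (support_nonempty.2 h)
    (fun d : Fin 2 →₀ ℕ => d.sum fun _ e => e)
  have hd' : d + Finsupp.single i 1 ∈ ψ.support := by
    rw [mem_support_iff, coeff_pderiv] at hd
    exact mem_support_iff.2 (left_ne_zero_of_mul hd)
  have := le_totalDegree hd'
  rw [Finsupp.sum_add_index' (by simp) (by simp), Finsupp.sum_single_index rfl] at this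
  rw [totalDegree, he]
  exact this

lemma totalDegree_X_mul_pderiv_le (i j : Fin 2) (ψ : MvPolynomial (Fin 2) ℝ) :
    (X j * pderiv i ψ).totalDegree ≤ ψ.totalDegree := by
  by_cases h : pderiv i ψ = 0
  · simp [h]
  · have h1 := totalDegree_mul (X j) (pderiv i ψ)
    have h2 := totalDegree_pderiv_lt i h
    rw [totalDegree_X] at h1
    omega

lemma totalDegree_pderiv_le (i : Fin 2) (ψ : MvPolynomial (Fin 2) ℝ) :
    (pderiv i ψ).totalDegree ≤ ψ.totalDegree := by
  by_cases h : pderiv i ψ = 0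
  · simp [h]
  · have h2 := totalDegree_pderiv_lt i h
    omega

lemma polyGen_mem_restrictTotalDegree (S m : ℝ≥0) (s γ : ℝ) {N : ℕ} {ψ : MvPolynomial (Fin 2) ℝ}
    (h : ψ ∈ restrictTotalDegree (Fin 2) ℝ N) :
    polyGen S m s γ ψ ∈ restrictTotalDegree (Fin 2) ℝ N := by
  have key : ∀ χ : MvPolynomial (Fin 2) ℝ, χ.totalDegree ≤ ψ.totalDegree →
      χ ∈ restrictTotalDegree (Fin 2) ℝ N := fun χ hχ =>
    (mem_restrictTotalDegree _ _ _).2 (hχ.trans ((mem_restrictTotalDegree _ _ _).1 h))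
  rw [polyGen_apply]
  refine Submodule.add_mem _ (Submodule.sub_mem _ (Submodule.smul_mem _ _ (Submodule.sub_mem _
    (Submodule.smul_mem _ _ ?_) (Submodule.smul_mem _ _ ?_))) (Submodule.smul_mem _ _ ?_))
    (Submodule.smul_mem _ _ ?_)
  · exact key _ (totalDegree_X_mul_pderiv_le _ _ _)
  · exact key _ (totalDegree_X_mul_pderiv_le _ _ _)
  · exact key _ (totalDegree_X_mul_pderiv_le _ _ _)
  · exact key _ ((totalDegree_pderiv_le _ _).trans (totalDegree_pderiv_le _ _))

/-! ### Sign changes of the variables -/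

/-- The substitution `q ↦ ε₀ q`, `p ↦ ε₁ p`. -/
noncomputable def scaleHom (ε : Fin 2 → ℝ) : MvPolynomial (Fin 2) ℝ →ₐ[ℝ] MvPolynomial (Fin 2) ℝ :=
  aeval fun i => ε i • X i

lemma scaleHom_X (ε : Fin 2 → ℝ) (i : Fin 2) : scaleHom ε (X i) = ε i • X i := by simp [scaleHom]

lemma polyFun_scaleHom (ε : Fin 2 → ℝ) (ψ : MvPolynomial (Fin 2) ℝ) (z : ℝ × ℝ) :
    polyFun (scaleHom ε ψ) z = polyFun ψ (ε 0 * z.1, ε 1 * z.2) := by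
  induction ψ using MvPolynomial.induction_on with
  | C c => simp [scaleHom, algebraMap_eq]
  | add ψ χ h1 h2 => simp [h1, h2]
  | mul_X ψ i h =>
    rw [map_mul, polyFun_mul, polyFun_mul, h, scaleHom_X, polyFun_smul]
    fin_cases i <;> simp

/-- Turns a symmetry under sign changes into the vanishing of coefficients of the wrong parity. -/
lemma coeff_scaleHom (ε : Fin 2 → ℝ) (ψ : MvPolynomial (Fin 2) ℝ) (d : Fin 2 →₀ ℕ) :
    coeff d (scaleHom ε ψ) = ε 0 ^ d 0 * ε 1 ^ d 1 * coeff d ψ := by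
  induction ψ using MvPolynomial.induction_on' with
  | monomial e c =>
    have : scaleHom ε (monomial e c) = monomial e (ε 0 ^ e 0 * ε 1 ^ e 1 * c) := by
      apply polyFun_injective
      ext z
      rw [polyFun_scaleHom]
      simp only [polyFun, eval_monomial, Finsupp.prod_fintype _ _ (fun i => pow_zero _),
        Fin.prod_univ_two]
      simp [mul_pow]; ring
    rw [this, coeff_monomial, coeff_monomial]
    split_ifs with h
    · rw [h]
    · simp
  | add ψ χ h1 h2 => simp [h1, h2, mul_add]

lemma pderiv_scaleHom (ε : Fin 2 → ℝ) (i : Fin 2) (ψ : MvPolynomial (Fin 2) ℝ) :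
    pderiv i (scaleHom ε ψ) = ε i • scaleHom ε (pderiv i ψ) := by
  induction ψ using MvPolynomial.induction_on with
  | C c => simp [scaleHom, algebraMap_eq]
  | add ψ χ h1 h2 => simp [h1, h2]
  | mul_X ψ j h =>
    rw [map_mul, pderiv_mul, h, pderiv_mul, map_add, map_mul, map_mul, scaleHom_X,
      Derivation.map_smul, pderiv_X]
    by_cases hij : i = j
    · subst hij; simp
    · simp [hij, smul_comm (ε i)]

/-- The generator commutes with `(q, p) ↦ (-q, -p)`. -/
lemma polyGen_scaleHom_neg (S m : ℝ≥0) (s γ : ℝ) (ψ : MvPolynomial (Fin 2) ℝ) :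
    polyGen S m s γ (scaleHom (fun _ => -1) ψ) = scaleHom (fun _ => -1) (polyGen S m s γ ψ) := by
  simp only [polyGen_apply, pderiv_scaleHom, Derivation.map_smul, map_add, map_sub, map_smul,
    map_mul, scaleHom_X]
  simp

/-- Momentum reversal changes the sign of the Hamiltonian part of the generator. -/
lemma polyGen_scaleHom_momentum (S m : ℝ≥0) (s γ : ℝ) (ψ : MvPolynomial (Fin 2) ℝ) :
    polyGen S m s γ (scaleHom ![1, -1] ψ) = scaleHom ![1, -1] (polyGen S m (-s) γ ψ) := by
  simp only [polyGen_apply, pderiv_scaleHom, Derivation.map_smul, map_add, map_sub, map_smul,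
    map_mul, scaleHom_X]
  simp [smul_add, smul_sub]

/-- The polynomials of total degree at most `N` that are odd under `(q, p) ↦ (-q, -p)`. -/
noncomputable def oddPolySubmodule (N : ℕ) : Submodule ℝ (MvPolynomial (Fin 2) ℝ) :=
  restrictTotalDegree (Fin 2) ℝ N ⊓
    LinearMap.ker ((scaleHom fun _ => -1).toLinearMap + LinearMap.id)

lemma mem_oddPolySubmodule {N : ℕ} {ψ : MvPolynomial (Fin 2) ℝ} :
    ψ ∈ oddPolySubmodule N ↔ ψ.totalDegree ≤ N ∧ scaleHom (fun _ => -1) ψ = -ψ := by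
  simp [oddPolySubmodule, mem_restrictTotalDegree, eq_neg_iff_add_eq_zero]

instance (N : ℕ) : FiniteDimensional ℝ (oddPolySubmodule N) :=
  Submodule.finiteDimensional_of_le (inf_le_left : _ ≤ restrictTotalDegree (Fin 2) ℝ N)

lemma polyGen_mem_oddPolySubmodule (S m : ℝ≥0) (s γ : ℝ) {N : ℕ} {ψ : MvPolynomial (Fin 2) ℝ}
    (h : ψ ∈ oddPolySubmodule N) : polyGen S m s γ ψ ∈ oddPolySubmodule N := by
  have h' := mem_oddPolySubmodule.1 h
  refine mem_oddPolySubmodule.2 ⟨(mem_restrictTotalDegree _ _ _).1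
    (polyGen_mem_restrictTotalDegree S m s γ h.1), ?_⟩
  rw [← polyGen_scaleHom_neg, h'.2, map_neg]

/-! ### Solvability of the Poisson equation in polynomials -/

lemma isOpenPosMeasure_phaseMeasure {S m : ℝ≥0} (hS : S ≠ 0) (hm : m ≠ 0) :
    (phaseMeasure S m).IsOpenPosMeasure := by
  have h1 := (gaussianReal_absolutelyContinuous' 0 hS).isOpenPosMeasure
  have h2 := (gaussianReal_absolutelyContinuous' 0 hm).isOpenPosMeasure
  unfold phaseMeasure
  infer_instance

/-- The energy identity forces `∂_p ψ = 0`. What remains of the equation is `s m⁻¹ p ∂_q ψ = 0`, and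
polynomials form a domain. -/
lemma eq_C_of_polyGen_eq_zero {S m : ℝ≥0} (hS : S ≠ 0) (hm : m ≠ 0) {s γ : ℝ} (hs : s ≠ 0)
    (hγ : 0 < γ) {ψ : MvPolynomial (Fin 2) ℝ} (h : polyGen S m s γ ψ = 0) :
    ψ = C (polyFun ψ 0) := by
  have he := (smoothGrowth_polyFun ψ).integral_self_mul_signedGen hS hm s γ
  rw [← polyFun_polyGen, h, dp_polyFun] at he
  have h0 : ∫ z, polyFun (pderiv 1 ψ) z ^ 2 ∂(phaseMeasure S m) = 0 := by
    have : γ * ∫ z, polyFun (pderiv 1 ψ) z ^ 2 ∂(phaseMeasure S m) = 0 := by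
      simpa [polyFun] using he
    exact (mul_eq_zero.1 this).resolve_left hγ.ne'
  have hi : Integrable (fun z => polyFun (pderiv 1 ψ) z ^ 2) (phaseMeasure S m) :=
    (polyGrowth_polyFun (pderiv 1 ψ)).memLp_two S m |>.integrable_sq
  rw [integral_eq_zero_iff_of_nonneg (fun z => sq_nonneg _) hi] at h0
  have := isOpenPosMeasure_phaseMeasure hS hm
  have h2 := (Continuous.ae_eq_iff_eq _ ((contDiff_polyFun (pderiv 1 ψ)).continuous.pow 2)
    continuous_const).1 h0
  have h1 : pderiv 1 ψ = 0 := by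
    apply polyFun_injective
    ext z
    have := pow_eq_zero_iff two_ne_zero |>.1 (show polyFun (pderiv 1 ψ) z ^ 2 = 0 from congrFun h2 z)
    simpa [polyFun] using this
  refine eq_C_of_pderiv_eq_zero ?_ h1
  rw [polyGen_apply, h1] at h
  have hm' : (m : ℝ) ≠ 0 := by exact_mod_cast hm
  simpa [hs, hm'] using h

/-- For positive friction every polynomial is in the range of the generator up to a constant. -/
lemma exists_polyGen_add_C {S m : ℝ≥0} (hS : S ≠ 0) (hm : m ≠ 0) {s γ : ℝ} (hs : s ≠ 0)
    (hγ : 0 < γ) (g : MvPolynomial (Fin 2) ℝ) :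
    ∃ (ψ : MvPolynomial (Fin 2) ℝ) (c : ℝ), polyGen S m s γ ψ + C c = g := by
  have hint := fun χ => (polyGrowth_polyFun χ).integrable S m
  let mean : MvPolynomial (Fin 2) ℝ →ₗ[ℝ] ℝ :=
    { toFun := fun ψ => ∫ z, polyFun ψ z ∂(phaseMeasure S m)
      map_add' := fun ψ χ => by simp only [polyFun_add]; exact integral_add (hint ψ) (hint χ)
      map_smul' := fun c ψ => by simp [integral_const_mul] }
  have mean_gen : ∀ ψ, mean (polyGen S m s γ ψ) = 0 := fun ψ => by
    have h := (smoothGrowth_polyFun ψ).integral_mul_signedGen_comm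
      (smoothGrowth_polyFun (C 1)) hS hm s γ
    rw [← polyFun_polyGen, ← polyFun_polyGen] at h
    have h0 : polyGen S m (-s) γ (C 1) = 0 := by simp [polyGen_apply]
    rw [h0] at h
    simpa [mean, polyFun] using h
  have mean_C : ∀ c, mean (C c) = c := fun c => by simp [mean]
  -- The generator kills constants and its range has mean zero. Adding the mean repairs both
  -- defects: `T` is injective on polynomials of bounded degree, hence surjective there.
  let T : MvPolynomial (Fin 2) ℝ →ₗ[ℝ] MvPolynomial (Fin 2) ℝ :=
    polyGen S m s γ + (Algebra.linearMap ℝ _) ∘ₗ mean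
  have hT : ∀ ψ, T ψ = polyGen S m s γ ψ + C (mean ψ) := fun ψ => rfl
  let V := restrictTotalDegree (Fin 2) ℝ g.totalDegree
  have hTV : ∀ ψ ∈ V, T ψ ∈ V := fun ψ hψ => by
    rw [hT]
    exact V.add_mem (polyGen_mem_restrictTotalDegree S m s γ hψ)
      ((mem_restrictTotalDegree _ _ _).2 (by simp))
  have hinj : Function.Injective (T.restrict hTV) := by
    rw [injective_iff_map_eq_zero]
    rintro ⟨ψ, hψ⟩ h
    have h0 : T ψ = 0 := congrArg Subtype.val h
    rw [hT] at h0
    have h1 : mean ψ = 0 := by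
      have := congrArg mean h0
      rwa [map_add, mean_gen, mean_C, zero_add, map_zero] at this
    rw [h1, map_zero, add_zero] at h0
    have h2 := eq_C_of_polyGen_eq_zero hS hm hs hγ h0
    have h3 : polyFun ψ 0 = 0 := by rw [← mean_C (polyFun ψ 0), ← h2, h1]
    rw [h3, map_zero] at h2
    exact Subtype.ext h2
  obtain ⟨ψ, hψ⟩ := LinearMap.injective_iff_surjective.1 hinj
    ⟨g, (mem_restrictTotalDegree _ _ _).2 le_rfl⟩
  exact ⟨ψ, mean ψ, congrArg Subtype.val hψ⟩

/-- The Hamiltonian flow reaches `(-q, -p)` after half a period, so no odd polynomial other than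
`0` is invariant under it. -/
lemma eq_zero_of_hamiltonian_eq_zero {S m : ℝ≥0} (hS : S ≠ 0) (hm : m ≠ 0)
    {ψ : MvPolynomial (Fin 2) ℝ} (hodd : scaleHom (fun _ => -1) ψ = -ψ)
    (h : polyGen S m 1 0 ψ = 0) : ψ = 0 := by
  have hS0 : (S : ℝ) ≠ 0 := by exact_mod_cast hS
  have hm0 : (m : ℝ) ≠ 0 := by exact_mod_cast hm
  have hpos : 0 < (S : ℝ) * m := by positivity
  -- `1 / r` is the angular frequency of the oscillator `q' = p / m`, `p' = -q / S`, whose explicit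
  -- solution is differentiated below; `r π` is half a period.
  obtain ⟨r, hr, hrr⟩ : ∃ r : ℝ, 0 < r ∧ r * r = S * m :=
    ⟨√(S * m), Real.sqrt_pos.2 hpos, Real.mul_self_sqrt hpos.le⟩
  apply polyFun_injective
  ext ⟨q, p⟩
  have hx : ∀ t : ℝ, HasDerivAt
      (fun t => q * Real.cos (t / r) + p * (r / m) * Real.sin (t / r))
      ((m : ℝ)⁻¹ * (p * Real.cos (t / r) - q * (m / r) * Real.sin (t / r))) t := fun t => by
    have ht := (hasDerivAt_id t).div_const r
    refine ((ht.cos.const_mul q).add (ht.sin.const_mul (p * (r / m)))).congr_deriv ?_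
    simp only [id]; field_simp; ring
  have hy : ∀ t : ℝ, HasDerivAt
      (fun t => p * Real.cos (t / r) - q * (m / r) * Real.sin (t / r))
      (-((S : ℝ)⁻¹ * (q * Real.cos (t / r) + p * (r / m) * Real.sin (t / r)))) t := fun t => by
    have ht := (hasDerivAt_id t).div_const r
    refine ((ht.cos.const_mul p).sub (ht.sin.const_mul (q * (m / r)))).congr_deriv ?_
    have hS' : (S : ℝ) = r * r / m := by field_simp; linarith
    rw [hS']
    simp only [id]; field_simp; ring
  have hd : ∀ t : ℝ, HasDerivAt (fun t => polyFun ψ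
      (q * Real.cos (t / r) + p * (r / m) * Real.sin (t / r),
        p * Real.cos (t / r) - q * (m / r) * Real.sin (t / r))) 0 t := fun t => by
    refine (hasDerivAt_polyFun_curve ψ (hx t) (hy t)).congr_deriv ?_
    have := congrArg (fun χ => polyFun χ
      (q * Real.cos (t / r) + p * (r / m) * Real.sin (t / r),
        p * Real.cos (t / r) - q * (m / r) * Real.sin (t / r))) h
    simp only [polyGen_apply, polyFun_add, polyFun_sub, polyFun_smul, polyFun_mul, polyFun_X_zero,
      polyFun_X_one] at this
    rw [show polyFun (0 : MvPolynomial (Fin 2) ℝ) = fun _ => 0 by ext; simp [polyFun]] at this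
    simp only at this
    linarith
  have h1 := is_const_of_deriv_eq_zero (fun t => (hd t).differentiableAt) (fun t => (hd t).deriv)
    (r * Real.pi) 0
  have h2 := congrArg (fun χ => polyFun χ (q, p)) hodd
  simp only [polyFun_scaleHom, polyFun_neg] at h2
  rw [mul_div_cancel_left₀ _ hr.ne'] at h1
  simp only [Real.cos_pi, Real.sin_pi, zero_div, Real.cos_zero, Real.sin_zero, mul_zero, add_zero,
    sub_zero, mul_one] at h1
  rw [show polyFun (0 : MvPolynomial (Fin 2) ℝ) (q, p) = 0 by simp [polyFun]]
  rw [show q * -1 = -1 * q by ring, show p * -1 = -1 * p by ring] at h1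
  linarith

/-- Oddness excludes the constants when `γ > 0`, and the conserved quantities, such as powers of the
energy, when `γ = 0`. -/
lemma polyGen_injOn_odd {S m : ℝ≥0} (hS : S ≠ 0) (hm : m ≠ 0) {γ : ℝ} (hγ : 0 ≤ γ)
    {ψ : MvPolynomial (Fin 2) ℝ} (hodd : scaleHom (fun _ => -1) ψ = -ψ)
    (h : polyGen S m 1 γ ψ = 0) : ψ = 0 := by
  rcases hγ.eq_or_lt with rfl | hγ
  · exact eq_zero_of_hamiltonian_eq_zero hS hm hodd h
  · have h1 := eq_C_of_polyGen_eq_zero hS hm one_ne_zero hγ h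
    have h2 := congrArg (fun χ => polyFun χ 0) hodd
    simp only [polyFun_scaleHom, polyFun_neg] at h2
    have h3 : polyFun ψ 0 = 0 := by
      simp only [Prod.fst_zero, Prod.snd_zero, mul_zero, ← Prod.zero_eq_mk] at h2
      linarith
    rw [h1, h3, map_zero]

/-- The generator, as an endomorphism of the odd polynomials of degree at most `N`. -/
noncomputable def oddGen (S m : ℝ≥0) (s γ : ℝ) (N : ℕ) :
    oddPolySubmodule N →ₗ[ℝ] oddPolySubmodule N :=
  (polyGen S m s γ).restrict fun _ h => polyGen_mem_oddPolySubmodule S m s γ h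

lemma oddGen_bijective {S m : ℝ≥0} (hS : S ≠ 0) (hm : m ≠ 0) {γ : ℝ} (hγ : 0 ≤ γ) (N : ℕ) :
    Function.Bijective (oddGen S m 1 γ N) := by
  have hinj : Function.Injective (oddGen S m 1 γ N) := by
    rw [injective_iff_map_eq_zero]
    rintro ⟨ψ, hψ⟩ h
    exact Subtype.ext (polyGen_injOn_odd hS hm hγ (mem_oddPolySubmodule.1 hψ).2
      (congrArg Subtype.val h))
  exact ⟨hinj, LinearMap.injective_iff_surjective.1 hinj⟩

end PolyFun

/-! ### Approximation by smooth compactly supported functions -/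

/-- The last bound, from `η 0 = 1` and the mean value inequality, gives the dilated cutoffs an
explicit rate of convergence to `1`. -/
lemma exists_smooth_cutoff : ∃ (η : ℝ → ℝ) (K : ℝ), ContDiff ℝ ∞ η ∧ HasCompactSupport η ∧
    (∀ x, |η x| ≤ 1) ∧ (∀ x, |deriv η x| ≤ K) ∧ (∀ x, |deriv (deriv η) x| ≤ K) ∧
    ∀ x, |η x - 1| ≤ K * |x| := by
  let b : ContDiffBump (0 : ℝ) := ⟨1, 2, one_pos, one_lt_two⟩
  have hb : ContDiff ℝ ∞ b := b.contDiff
  have hb1 : ContDiff ℝ ∞ (deriv b) := ((contDiff_infty_iff_deriv).1 hb).2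
  have hb2 : ContDiff ℝ ∞ (deriv (deriv b)) := ((contDiff_infty_iff_deriv).1 hb1).2
  obtain ⟨K1, hK1⟩ := b.hasCompactSupport.deriv.exists_bound_of_continuous hb1.continuous
  obtain ⟨K2, hK2⟩ := b.hasCompactSupport.deriv.deriv.exists_bound_of_continuous hb2.continuous
  refine ⟨b, max K1 K2, hb, b.hasCompactSupport, fun x => ?_,
    fun x => (hK1 x).trans (le_max_left _ _), fun x => (hK2 x).trans (le_max_right _ _),
    fun x => ?_⟩
  · rw [abs_of_nonneg b.nonneg]; exact b.le_one
  · have h := Convex.norm_image_sub_le_of_norm_deriv_le (f := b) (s := Set.univ) (x := 0) (y := x)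
      (fun y _ => (hb.differentiable (by simp)) y)
      (fun y _ => (hK1 y).trans (le_max_left K1 K2)) convex_univ trivial trivial
    have h0 : b 0 = 1 := b.one_of_mem_closedBall (by simp [b])
    simpa [h0] using h

/-- `u` multiplied by the dilated cutoff `η (c q) η (c p)`. -/
noncomputable def cutoffMul (η : ℝ → ℝ) (c : ℝ) (u : ℝ × ℝ → ℝ) (z : ℝ × ℝ) : ℝ :=
  η (c * z.1) * η (c * z.2) * u z

lemma contDiff_cutoffMul {η : ℝ → ℝ} (hη : ContDiff ℝ ∞ η) (c : ℝ) {u : ℝ × ℝ → ℝ}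
    (hu : ContDiff ℝ ∞ u) : ContDiff ℝ ∞ (cutoffMul η c u) := by
  unfold cutoffMul
  exact ((hη.comp (contDiff_const.mul contDiff_fst)).mul
    (hη.comp (contDiff_const.mul contDiff_snd))).mul hu

lemma hasCompactSupport_cutoffMul {η : ℝ → ℝ} (hη : HasCompactSupport η) {c : ℝ} (hc : c ≠ 0)
    (u : ℝ × ℝ → ℝ) : HasCompactSupport (cutoffMul η c u) := by
  have h1 : HasCompactSupport fun x : ℝ => η (c * x) :=
    hη.comp_homeomorph (Homeomorph.mulLeft₀ c hc)
  refine HasCompactSupport.intro (h1.isCompact.prod h1.isCompact) fun z hz => ?_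
  simp only [Set.mem_prod, not_and_or] at hz
  rcases hz with hz | hz
  · simp [cutoffMul, show η (c * z.1) = 0 from
      image_eq_zero_of_notMem_tsupport (f := fun x => η (c * x)) hz]
  · simp [cutoffMul, show η (c * z.2) = 0 from
      image_eq_zero_of_notMem_tsupport (f := fun x => η (c * x)) hz]

lemma dq_cutoffMul {η : ℝ → ℝ} (hη : Differentiable ℝ η) (c : ℝ) {u : ℝ × ℝ → ℝ}
    (hu : Differentiable ℝ u) (z : ℝ × ℝ) :
    dq (cutoffMul η c u) z = c * deriv η (c * z.1) * η (c * z.2) * u z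
      + η (c * z.1) * η (c * z.2) * dq u z := by
  have h1 : HasDerivAt (fun q => η (c * q)) (deriv η (c * z.1) * c) z.1 :=
    (hη (c * z.1)).hasDerivAt.comp z.1 (by simpa using (hasDerivAt_id z.1).const_mul c)
  have h := (h1.mul_const (η (c * z.2))).mul (hasDerivAt_dq hu z)
  refine Eq.trans h.deriv ?_
  ring

lemma dp_cutoffMul {η : ℝ → ℝ} (hη : Differentiable ℝ η) (c : ℝ) {u : ℝ × ℝ → ℝ}
    (hu : Differentiable ℝ u) (z : ℝ × ℝ) :
    dp (cutoffMul η c u) z = c * η (c * z.1) * deriv η (c * z.2) * u z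
      + η (c * z.1) * η (c * z.2) * dp u z := by
  have h1 : HasDerivAt (fun q => η (c * q)) (deriv η (c * z.2) * c) z.2 :=
    (hη (c * z.2)).hasDerivAt.comp z.2 (by simpa using (hasDerivAt_id z.2).const_mul c)
  have h := (h1.const_mul (η (c * z.1))).mul (hasDerivAt_dp hu z)
  refine Eq.trans h.deriv ?_
  ring

lemma dp_dp_cutoffMul {η : ℝ → ℝ} (hη : ContDiff ℝ ∞ η) (c : ℝ) {u : ℝ × ℝ → ℝ}
    (hu : ContDiff ℝ ∞ u) (z : ℝ × ℝ) :
    dp (dp (cutoffMul η c u)) z = c ^ 2 * η (c * z.1) * deriv (deriv η) (c * z.2) * u z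
      + 2 * c * η (c * z.1) * deriv η (c * z.2) * dp u z
      + η (c * z.1) * η (c * z.2) * dp (dp u) z := by
  have hη0 : Differentiable ℝ η := hη.differentiable (by simp)
  have hη1 : Differentiable ℝ (deriv η) :=
    ((contDiff_infty_iff_deriv).1 hη).2.differentiable (by simp)
  have hu0 : Differentiable ℝ u := hu.differentiable (by simp)
  have hu1 : Differentiable ℝ (dp u) := (contDiff_dp hu).differentiable (by simp)
  have hc : HasDerivAt (fun p => c * p) c z.2 := by simpa using (hasDerivAt_id z.2).const_mul c
  have h0 : HasDerivAt (fun q => η (c * q)) (deriv η (c * z.2) * c) z.2 :=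
    (hη0 (c * z.2)).hasDerivAt.comp z.2 hc
  have h1 : HasDerivAt (fun q => deriv η (c * q)) (deriv (deriv η) (c * z.2) * c) z.2 :=
    (hη1 (c * z.2)).hasDerivAt.comp z.2 hc
  rw [show dp (cutoffMul η c u) = _ from funext fun z => dp_cutoffMul hη0 c hu0 z]
  have h := ((h1.const_mul (c * η (c * z.1))).mul (hasDerivAt_dp hu0 z)).add
    ((h0.const_mul (η (c * z.1))).mul (hasDerivAt_dp hu1 z))
  refine Eq.trans h.deriv ?_
  ring

/-- A smooth function of polynomial growth is a limit of test functions, uniformly with respect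
to a weight of polynomial growth, and so is its image under the generator. -/
lemma SmoothGrowth.exists_approx {u : ℝ × ℝ → ℝ} (hu : SmoothGrowth u) (S m : ℝ≥0) (s γ : ℝ) :
    ∃ (R : ℝ × ℝ → ℝ) (h : ℕ → ℝ × ℝ → ℝ), PolyGrowth R ∧
      (∀ n, ContDiff ℝ ∞ (h n) ∧ HasCompactSupport (h n)) ∧
      (∀ n z, |h n z - u z| ≤ (1 / (n + 1 : ℝ)) * R z) ∧
      ∀ n z, |_root_.signedGen S m s γ (h n) z - _root_.signedGen S m s γ u z|
        ≤ (1 / (n + 1 : ℝ)) * R z := by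
  obtain ⟨η, K, hη, hηs, hη0, hη1, hη2, hηl⟩ := exists_smooth_cutoff
  have hK : 0 ≤ K := (abs_nonneg _).trans (hη1 0)
  let G := _root_.signedGen S m s γ u
  let W : ℝ × ℝ → ℝ := fun z => |z.1| + |z.2|
  -- `R1` and `R2` control the cutoff error on `u` and on its image `G`; `R3` controls the
  -- commutator of the generator with the cutoff.
  let R1 : ℝ × ℝ → ℝ := fun z => K * (W z * |u z|)
  let R2 : ℝ × ℝ → ℝ := fun z => K * (W z * |G z|)
  let R3 : ℝ × ℝ → ℝ := fun z => K * (|s * (m : ℝ)⁻¹ * z.2 * u z| + |s * (S : ℝ)⁻¹ * z.1 * u z|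
    + |γ * (m : ℝ)⁻¹ * z.2 * u z| + |γ * u z| + |2 * γ * _root_.dp u z|)
  have hW : PolyGrowth W := PolyGrowth.fst.abs.add PolyGrowth.snd.abs
  have hR1 : PolyGrowth R1 := (hW.mul hu.self.abs).const_mul K
  have hR2 : PolyGrowth R2 := (hW.mul (hu.signedGen S m s γ).abs).const_mul K
  have hR3 : PolyGrowth R3 :=
    ((((((PolyGrowth.snd.const_mul _).mul hu.self).abs.add
      ((PolyGrowth.fst.const_mul _).mul hu.self).abs).add
      ((PolyGrowth.snd.const_mul _).mul hu.self).abs).add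
      (hu.self.const_mul _).abs).add (hu.dp.const_mul _).abs).const_mul K
  have cut : ∀ (c : ℝ) (z : ℝ × ℝ), 0 < c → |η (c * z.1) * η (c * z.2) - 1| ≤ c * (K * W z) := by
    intro c z hc
    have e0 := hηl (c * z.1)
    have e1 := hηl (c * z.2)
    rw [abs_mul, abs_of_pos hc] at e0 e1
    calc |η (c * z.1) * η (c * z.2) - 1|
        = |(η (c * z.1) - 1) * η (c * z.2) + (η (c * z.2) - 1)| := by ring_nf
      _ ≤ |η (c * z.1) - 1| * |η (c * z.2)| + |η (c * z.2) - 1| := by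
          rw [← abs_mul]; exact abs_add_le _ _
      _ ≤ |η (c * z.1) - 1| * 1 + |η (c * z.2) - 1| := by gcongr; exact hη0 _
      _ ≤ c * (K * W z) := by simp only [W]; linarith
  have R1nn : ∀ z, 0 ≤ R1 z := fun z => by positivity
  have R2nn : ∀ z, 0 ≤ R2 z := fun z => by positivity
  have R3nn : ∀ z, 0 ≤ R3 z := fun z => by positivity
  refine ⟨fun z => R1 z + (R2 z + R3 z), fun n => cutoffMul η (1 / (n + 1 : ℝ)) u,
    hR1.add (hR2.add hR3), fun n => ⟨contDiff_cutoffMul hη _ hu.contDiff,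
      hasCompactSupport_cutoffMul hηs (by positivity) u⟩, fun n z => ?_, fun n z => ?_⟩
  · set c : ℝ := 1 / (n + 1 : ℝ)
    have hc : 0 < c := by positivity
    calc |cutoffMul η c u z - u z| = |η (c * z.1) * η (c * z.2) - 1| * |u z| := by
          rw [← abs_mul, cutoffMul]; ring_nf
      _ ≤ c * (K * W z) * |u z| := by gcongr; exact cut c z hc
      _ = c * R1 z := by simp only [R1]; ring
      _ ≤ _ := by gcongr; linarith [R2nn z, R3nn z]
  · set c : ℝ := 1 / (n + 1 : ℝ)
    have hc : 0 < c := by positivity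
    have hc1 : c ≤ 1 := by
      simp only [c]; rw [div_le_one (by positivity)]; linarith [Nat.cast_nonneg (α := ℝ) n]
    have hud := hu.contDiff.differentiable (by simp : (∞ : WithTop ℕ∞) ≠ 0)
    have hηd := hη.differentiable (by simp : (∞ : WithTop ℕ∞) ≠ 0)
    have b1 : ∀ x y, |deriv η x * η y| ≤ K := fun x y => by
      rw [abs_mul]; simpa using mul_le_mul (hη1 x) (hη0 y) (abs_nonneg _) hK
    have b2 : ∀ x y, |η y * deriv η x| ≤ K := fun x y => by rw [mul_comm]; exact b1 x y
    have b3 : ∀ x y, |c * (η y * deriv (deriv η) x)| ≤ K := fun x y => by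
      rw [abs_mul, abs_mul, abs_of_pos hc]
      calc c * (|η y| * |deriv (deriv η) x|) ≤ 1 * (1 * K) := by
            gcongr
            · exact hη0 y
            · exact hη2 x
        _ = K := by ring
    -- Every commutator term carries a factor `c`. The second derivative of the cutoff carries `c ^
    -- 2`, whose spare factor is absorbed in `b3` through `c ≤ 1`.
    have hsplit : _root_.signedGen S m s γ (cutoffMul η c u) z - _root_.signedGen S m s γ u z
        = (η (c * z.1) * η (c * z.2) - 1) * G z
          + c * ((deriv η (c * z.1) * η (c * z.2)) * (s * (m : ℝ)⁻¹ * z.2 * u z)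
            - (η (c * z.1) * deriv η (c * z.2)) * (s * (S : ℝ)⁻¹ * z.1 * u z)
            - (η (c * z.1) * deriv η (c * z.2)) * (γ * (m : ℝ)⁻¹ * z.2 * u z)
            + (c * (η (c * z.1) * deriv (deriv η) (c * z.2))) * (γ * u z)
            + (η (c * z.1) * deriv η (c * z.2)) * (2 * γ * _root_.dp u z)) := by
      simp only [G, _root_.signedGen, dq_cutoffMul hηd c hud, dp_cutoffMul hηd c hud,
        dp_dp_cutoffMul hη c hu.contDiff]
      ring
    have key : ∀ {a b : ℝ}, |a| ≤ K → |a * b| ≤ K * |b| := fun {a b} h => by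
      rw [abs_mul]; gcongr
    rw [hsplit]
    calc _ ≤ |(η (c * z.1) * η (c * z.2) - 1) * G z| + c * R3 z := by
          refine (abs_add_le _ _).trans ?_
          gcongr
          rw [abs_mul, abs_of_pos hc]
          gcongr
          simp only [R3, mul_add]
          refine (abs_add_le _ _).trans (add_le_add ((abs_add_le _ _).trans (add_le_add
            ((abs_sub _ _).trans (add_le_add ((abs_sub _ _).trans (add_le_add ?_ ?_)) ?_)) ?_)) ?_)
          · exact key (b1 _ _)
          · exact key (b2 _ _)
          · exact key (b2 _ _)
          · exact key (b3 _ _)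
          · exact key (b2 _ _)
      _ ≤ c * R2 z + c * R3 z := by
          gcongr
          rw [abs_mul]
          calc _ ≤ c * (K * W z) * |G z| := by gcongr; exact cut c z hc
            _ = c * R2 z := by simp only [R2]; ring
      _ ≤ _ := by rw [← mul_add]; gcongr; linarith [R1nn z]

lemma tendsto_eLpNorm_of_le_one_div_mul {S m : ℝ≥0} {R : ℝ × ℝ → ℝ} (hR : PolyGrowth R)
    {g : ℕ → ℝ × ℝ → ℝ} (hg : ∀ n z, |g n z| ≤ (1 / (n + 1 : ℝ)) * R z) :
    Tendsto (fun n => eLpNorm (g n) 2 (phaseMeasure S m)) atTop (𝓝 0) := by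
  have hR2 := hR.memLp_two S m
  have hle : ∀ n, eLpNorm (g n) 2 (phaseMeasure S m)
      ≤ ENNReal.ofReal (1 / (n + 1 : ℝ)) * eLpNorm R 2 (phaseMeasure S m) := fun n => by
    refine eLpNorm_le_mul_eLpNorm_of_ae_le_mul (Eventually.of_forall fun z => ?_) 2
    refine (hg n z).trans ?_
    gcongr
    exact le_abs_self _
  refine tendsto_of_tendsto_of_tendsto_of_le_of_le tendsto_const_nhds ?_ (fun n => zero_le) hle
  have h0 : Tendsto (fun n : ℕ => ENNReal.ofReal (1 / (n + 1 : ℝ))) atTop (𝓝 0) := by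
    simpa using ENNReal.tendsto_ofReal tendsto_one_div_add_atTop_nhds_zero_nat
  simpa using ENNReal.Tendsto.mul_const h0 (Or.inr hR2.2.ne)

/-- A square integrable function orthogonal to the image of the test functions is orthogonal to
the image of every smooth function of polynomial growth. -/
lemma SmoothGrowth.integral_mul_signedGen_eq_zero {u : ℝ × ℝ → ℝ} (hu : SmoothGrowth u)
    {S m : ℝ≥0} {s γ : ℝ} {φ : ℝ × ℝ → ℝ} (hφ : MemLp φ 2 (phaseMeasure S m))
    (h0 : ∀ h : ℝ × ℝ → ℝ, ContDiff ℝ ∞ h → HasCompactSupport h →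
      ∫ z, φ z * _root_.signedGen S m s γ h z ∂(phaseMeasure S m) = 0) :
    ∫ z, φ z * _root_.signedGen S m s γ u z ∂(phaseMeasure S m) = 0 := by
  obtain ⟨R, h, hR, hh, -, hgen⟩ := hu.exists_approx S m s γ
  have iφ : ∀ {g : ℝ × ℝ → ℝ}, PolyGrowth g → Integrable (fun z => φ z * g z) (phaseMeasure S m) :=
    fun hg => hφ.integrable_mul (hg.memLp_two S m)
  have hbound : ∀ n : ℕ, |∫ z, φ z * _root_.signedGen S m s γ u z ∂(phaseMeasure S m)|
      ≤ (1 / (n + 1 : ℝ)) * ∫ z, |φ z * R z| ∂(phaseMeasure S m) := fun n => by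
    have hn := SmoothGrowth.of_hasCompactSupport (hh n).1 (hh n).2
    have e : ∫ z, φ z * _root_.signedGen S m s γ u z ∂(phaseMeasure S m)
        = ∫ z, (φ z * _root_.signedGen S m s γ u z - φ z * _root_.signedGen S m s γ (h n) z)
          ∂(phaseMeasure S m) := by
      rw [integral_sub (iφ (hu.signedGen S m s γ)) (iφ (hn.signedGen S m s γ)),
        h0 _ (hh n).1 (hh n).2, sub_zero]
    rw [e, ← integral_const_mul]
    refine (abs_integral_le_integral_abs).trans (integral_mono
      ((iφ (hu.signedGen S m s γ)).sub (iφ (hn.signedGen S m s γ))).abs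
      ((iφ hR).abs.const_mul _) fun z => ?_)
    simp only
    rw [← mul_sub, abs_mul, abs_mul, abs_sub_comm, mul_left_comm]
    gcongr
    refine (hgen n z).trans ?_
    gcongr
    exact le_abs_self _
  have ht : Tendsto (fun n : ℕ => (1 / (n + 1 : ℝ)) * ∫ z, |φ z * R z| ∂(phaseMeasure S m)) atTop
      (𝓝 0) := by
    simpa using tendsto_one_div_add_atTop_nhds_zero_nat.mul_const
      (∫ z, |φ z * R z| ∂(phaseMeasure S m))
  exact abs_nonpos_iff.1 (ge_of_tendsto' ht hbound)

/-! ### Density of the polynomials -/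

lemma integrable_exp_abs_gaussianReal (v : ℝ≥0) (t : ℝ) :
    Integrable (fun x : ℝ => Real.exp (|t| * |x|)) (gaussianReal 0 v) := by
  have h := (integrable_exp_mul_gaussianReal (μ := 0) (v := v) t).add
    (integrable_exp_mul_gaussianReal (μ := 0) (v := v) (-t))
  refine h.mono' (by fun_prop) (Eventually.of_forall fun x => ?_)
  rw [Real.norm_eq_abs, Real.abs_exp, ← abs_mul]
  simp only [Pi.add_apply]
  rcases abs_choice (t * x) with e | e <;> rw [e]
  · linarith [Real.exp_pos (-t * x)]
  · rw [neg_mul]; linarith [Real.exp_pos (t * x)]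

/-- Supplies, after Cauchy–Schwarz against `φ`, the dominating function for expanding characters in
power series. -/
lemma memLp_two_exp_abs_phaseMeasure (S m : ℝ≥0) (a b : ℝ) :
    MemLp (fun z : ℝ × ℝ => Real.exp (|a| * |z.1| + |b| * |z.2|)) 2 (phaseMeasure S m) := by
  rw [memLp_two_iff_integrable_sq (by fun_prop)]
  have := (integrable_exp_abs_gaussianReal S (2 * a)).mul_prod
    (integrable_exp_abs_gaussianReal m (2 * b))
  refine this.congr (Eventually.of_forall fun z => ?_)
  simp only
  rw [← Real.exp_add, ← Real.exp_nat_mul, abs_mul, abs_mul, abs_two]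
  congr 1; push_cast; ring

/-- A square integrable function orthogonal to all polynomials has vanishing Fourier transform. -/
lemma integral_mul_cexp_eq_zero {S m : ℝ≥0} {φ : ℝ × ℝ → ℝ} (hφ : MemLp φ 2 (phaseMeasure S m))
    (h0 : ∀ ψ, ∫ z, φ z * polyFun ψ z ∂(phaseMeasure S m) = 0) (a b : ℝ) :
    ∫ z, (φ z : ℂ) * Complex.exp (((a * z.1 + b * z.2 : ℝ) : ℂ) * Complex.I)
      ∂(phaseMeasure S m) = 0 := by
  -- The terms of the exponential series times `φ`: each is `φ` times a polynomial, up to a complex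
  -- constant, and so integrates to zero.
  let F : ℕ → ℝ × ℝ → ℂ := fun n z => (φ z : ℂ) *
    ((((a * z.1 + b * z.2 : ℝ) : ℂ) * Complex.I) ^ n / (n.factorial : ℂ))
  have hφm := hφ.1
  have hterm : ∀ n, ∫ z, F n z ∂(phaseMeasure S m) = 0 := fun n => by
    have h := h0 ((MvPolynomial.C a * MvPolynomial.X 0 + MvPolynomial.C b * MvPolynomial.X 1) ^ n)
    simp only [polyFun_pow, polyFun_add, polyFun_mul, polyFun_C, polyFun_X_zero,
      polyFun_X_one] at h
    have e : ∀ z, F n z = ((φ z * (a * z.1 + b * z.2) ^ n : ℝ) : ℂ)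
        * (Complex.I ^ n / (n.factorial : ℂ)) := fun z => by
      simp only [F, mul_pow]; push_cast; ring
    simp_rw [e]
    rw [integral_mul_const, integral_complex_ofReal, h]
    simp
  have hE := memLp_two_exp_abs_phaseMeasure S m a b
  have hdom : Integrable (fun z => |φ z| * Real.exp (|a| * |z.1| + |b| * |z.2|))
      (phaseMeasure S m) := hφ.norm.integrable_mul hE
  have habs : ∀ z : ℝ × ℝ, |a * z.1 + b * z.2| ≤ |a| * |z.1| + |b| * |z.2| := fun z => by
    rw [← abs_mul, ← abs_mul]; exact abs_add_le _ _
  have hsum := hasSum_integral_of_dominated_convergence (μ := phaseMeasure S m) (F := F)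
    (f := fun z => (φ z : ℂ) * Complex.exp (((a * z.1 + b * z.2 : ℝ) : ℂ) * Complex.I))
    (fun n z => |φ z| * ((|a| * |z.1| + |b| * |z.2|) ^ n / n.factorial))
    (fun n => (Complex.continuous_ofReal.comp_aestronglyMeasurable hφm).mul
      (by fun_prop : Continuous fun z : ℝ × ℝ => ((((a * z.1 + b * z.2 : ℝ) : ℂ) * Complex.I) ^ n /
        (n.factorial : ℂ))).aestronglyMeasurable)
    (fun n => Eventually.of_forall fun z => by
      simp only [F, norm_mul, norm_div, norm_pow, Complex.norm_real, Complex.norm_I, mul_one,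
        Real.norm_eq_abs, Complex.norm_natCast]
      gcongr
      exact habs z)
    (Eventually.of_forall fun z => (Real.summable_pow_div_factorial _).mul_left _)
    (by
      refine hdom.congr (Eventually.of_forall fun z => ?_)
      simp only
      rw [tsum_mul_left, Real.exp_eq_exp_ℝ, NormedSpace.exp_eq_tsum_div])
    (Eventually.of_forall fun z => by
      refine HasSum.mul_left _ ?_
      rw [Complex.exp_eq_exp_ℂ]
      exact NormedSpace.expSeries_div_hasSum_exp _)
  simp only [hterm] at hsum
  exact hsum.unique hasSum_zero

/-- The polynomials are dense in `L²` of the Gaussian measure on phase space. -/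
lemma ae_eq_zero_of_forall_polyFun {S m : ℝ≥0} {φ : ℝ × ℝ → ℝ} (hφ : MemLp φ 2 (phaseMeasure S m))
    (h0 : ∀ ψ, ∫ z, φ z * polyFun ψ z ∂(phaseMeasure S m) = 0) :
    φ =ᵐ[phaseMeasure S m] 0 := by
  have hi : Integrable φ (phaseMeasure S m) := hφ.integrable (by norm_num)
  have hm := hi.1.aemeasurable
  have hmp : AEMeasurable (fun z => (φ z).toNNReal) (phaseMeasure S m) := hm.real_toNNReal
  have hmn : AEMeasurable (fun z => (-φ z).toNNReal) (phaseMeasure S m) := hm.neg.real_toNNReal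
  -- The positive and negative parts of `φ` are densities of two finite measures. The vanishing
  -- Fourier transform says that their characteristic functions agree, so the measures and then the
  -- densities coincide.
  let P := (phaseMeasure S m).withDensity fun z => ((φ z).toNNReal : ENNReal)
  let N := (phaseMeasure S m).withDensity fun z => ((-φ z).toNNReal : ENNReal)
  have fP : IsFiniteMeasure P := isFiniteMeasure_withDensity_ofReal hi.2
  have fN : IsFiniteMeasure N := isFiniteMeasure_withDensity_ofReal hi.neg.2
  have hPN : P = N := by
    refine Measure.ext_of_charFunDual (funext fun L => ?_)
    rw [charFunDual_apply, charFunDual_apply,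
      integral_withDensity_eq_integral_smul₀ hmp, integral_withDensity_eq_integral_smul₀ hmn,
      ← sub_eq_zero]
    have hLz : ∀ z : ℝ × ℝ, L z = L (1, 0) * z.1 + L (0, 1) * z.2 := fun z => by
      have : z = z.1 • ((1, 0) : ℝ × ℝ) + z.2 • ((0, 1) : ℝ × ℝ) := by ext <;> simp
      conv_lhs => rw [this]
      simp only [map_add, map_smul, smul_eq_mul]; ring
    have hb : ∀ z, ‖Complex.exp ((L z : ℂ) * Complex.I)‖ ≤ 1 := fun z => by
      rw [Complex.norm_exp_ofReal_mul_I]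
    have hc : AEStronglyMeasurable (fun z => Complex.exp ((L z : ℂ) * Complex.I))
        (phaseMeasure S m) := by fun_prop
    have hint : ∀ {g : ℝ × ℝ → ℝ}, Integrable g (phaseMeasure S m) →
        Integrable (fun z => (g z).toNNReal • Complex.exp ((L z : ℂ) * Complex.I))
          (phaseMeasure S m) := fun {g} hg => by
      refine (hg.real_toNNReal.ofReal (𝕜 := ℂ)).mul_bdd hc (Eventually.of_forall hb) |>.congr
        (Eventually.of_forall fun z => ?_)
      simp [NNReal.smul_def]
    have hin : Integrable (fun z => (-φ z).toNNReal • Complex.exp ((L z : ℂ) * Complex.I))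
        (phaseMeasure S m) := hint hi.neg
    rw [← integral_sub (hint hi) hin, ← integral_mul_cexp_eq_zero hφ h0 (L (1, 0))
      (L (0, 1))]
    congr 1; ext z
    simp only [← hLz, NNReal.smul_def, Complex.real_smul, ← sub_mul, Real.coe_toNNReal',
      ← Complex.ofReal_sub]
    congr 2
    rcases le_total (φ z) 0 with h | h
    · rw [max_eq_right h, max_eq_left (by simpa using h)]; ring
    · rw [max_eq_left h, max_eq_right (by simpa using h)]; ring
  have h1 := (withDensity_eq_iff hmp.coe_nnreal_ennreal hmn.coe_nnreal_ennreal
    (hi.lintegral_lt_top).ne).1 hPN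
  filter_upwards [h1] with z hz
  have hz' : (φ z).toNNReal = (-φ z).toNNReal := by exact_mod_cast hz
  have hz2 := congrArg ((↑) : ℝ≥0 → ℝ) hz'
  simp only [Real.coe_toNNReal'] at hz2
  rcases le_total (φ z) 0 with h | h
  · rw [max_eq_right h, max_eq_left (by simpa using h)] at hz2; simp; linarith
  · rw [max_eq_left h, max_eq_right (by simpa using h)] at hz2; simp; linarith

/-! ### Weak and strong solutions of the Poisson equation -/

lemma PolyGrowth.integrable_memLp_mul {g : ℝ × ℝ → ℝ} (hg : PolyGrowth g) {S m : ℝ≥0}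
    {φ : ℝ × ℝ → ℝ} (hφ : MemLp φ 2 (phaseMeasure S m)) :
    Integrable (fun z => φ z * g z) (phaseMeasure S m) :=
  hφ.integrable_mul (hg.memLp_two S m)

/-- Uniqueness of the solution of the Poisson equation in the sense of distributions. -/
lemma IsPoissonSolution.ae_eq {S m : ℝ≥0} (hS : S ≠ 0) (hm : m ≠ 0) {γ : ℝ} (hγ : 0 < γ)
    {f : ℝ → ℝ} {φ₁ φ₂ : ℝ × ℝ → ℝ} (h₁ : IsPoissonSolution S m γ f φ₁)
    (h₂ : IsPoissonSolution S m γ f φ₂) : φ₁ =ᵐ[phaseMeasure S m] φ₂ := by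
  have hχ : MemLp (fun z => φ₁ z - φ₂ z) 2 (phaseMeasure S m) := h₁.memLp.sub h₂.memLp
  have i₁ : Integrable φ₁ (phaseMeasure S m) := h₁.memLp.integrable (by norm_num)
  have i₂ : Integrable φ₂ (phaseMeasure S m) := h₂.memLp.integrable (by norm_num)
  have hweak : ∀ h : ℝ × ℝ → ℝ, ContDiff ℝ ∞ h → HasCompactSupport h →
      ∫ z, (φ₁ z - φ₂ z) * signedGen S m (-1) γ h z ∂(phaseMeasure S m) = 0 := by
    intro h hh hs
    have hg := (SmoothGrowth.of_hasCompactSupport hh hs).signedGen S m (-1) γ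
    have e₁ := h₁.weak h hh hs
    have e₂ := h₂.weak h hh hs
    simp only [sub_mul]
    rw [integral_sub
      (hg.integrable_memLp_mul h₁.memLp) (hg.integrable_memLp_mul h₂.memLp), signedGen_neg_one]
    linarith
  have hi : Integrable (fun z => φ₁ z - φ₂ z) (phaseMeasure S m) := i₁.sub i₂
  have hzero : ∫ z, (φ₁ z - φ₂ z) ∂(phaseMeasure S m) = 0 := by
    rw [integral_sub i₁ i₂, h₁.mean_zero, h₂.mean_zero, sub_zero]
  have horth : ∀ g, ∫ z, (φ₁ z - φ₂ z) * polyFun g z ∂(phaseMeasure S m) = 0 := by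
    intro g
    -- With `s = -1` this solves the adjoint equation: the image part is orthogonal to the
    -- difference by approximation, the constant by the zero mean.
    obtain ⟨ψ, c, rfl⟩ := exists_polyGen_add_C hS hm (s := -1) (by norm_num) hγ g
    have hψ := smoothGrowth_polyFun ψ
    simp only [polyFun_add, polyFun_C, mul_add, polyFun_polyGen]
    rw [integral_add ((hψ.signedGen S m (-1) γ).integrable_memLp_mul hχ)
      (hi.mul_const c), hψ.integral_mul_signedGen_eq_zero hχ hweak, integral_mul_const,
      hzero, zero_mul, add_zero]
  filter_upwards [ae_eq_zero_of_forall_polyFun hχ horth] with z hz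
  exact sub_eq_zero.1 hz

/-- Integrability is not needed: invariance under the reflection holds for the integral with its
default value as well. -/
lemma integral_eq_zero_of_odd {v : ℝ≥0} {f : ℝ → ℝ} (hf : ∀ x, f (-x) = -f x) :
    ∫ x, f x ∂(gaussianReal 0 v) = 0 := by
  have h : ∫ x, f x ∂((gaussianReal 0 v).map (MeasurableEquiv.neg ℝ))
      = ∫ x, f (-x) ∂(gaussianReal 0 v) := integral_map_equiv _ _
  have hmap : (gaussianReal 0 v).map (MeasurableEquiv.neg ℝ) = gaussianReal 0 v := by
    simpa using gaussianReal_map_neg (μ := 0) (v := v)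
  rw [hmap] at h
  simp only [hf, integral_neg] at h
  linarith

lemma integral_phaseMeasure_eq_zero_of_odd {S m : ℝ≥0} {f : ℝ × ℝ → ℝ} (hf : ∀ z, f (-z) = -f z) :
    ∫ z, f z ∂(phaseMeasure S m) = 0 := by
  have hp : ∀ v : ℝ≥0, MeasurePreserving (fun x : ℝ => -x) (gaussianReal 0 v) (gaussianReal 0 v) :=
    fun v => ⟨measurable_neg, by simpa using gaussianReal_map_neg (μ := 0) (v := v)⟩
  have h := ((hp S).prod (hp m)).integral_comp (MeasurableEquiv.neg (ℝ × ℝ)).measurableEmbedding f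
  have h' : ∫ z, f (-z) ∂(phaseMeasure S m) = ∫ z, f z ∂(phaseMeasure S m) := h
  simp only [hf, integral_neg] at h'
  linarith

lemma isPoissonSolution_polyFun {S m : ℝ≥0} (hS : S ≠ 0) (hm : m ≠ 0) {γ : ℝ} {f : ℝ → ℝ}
    {ψ : MvPolynomial (Fin 2) ℝ} (hodd : scaleHom (fun _ => -1) ψ = -ψ)
    (h : ∀ z, -langevinGen S m γ (polyFun ψ) z = centred S f z) :
    IsPoissonSolution S m γ f (polyFun ψ) where
  memLp := (polyGrowth_polyFun ψ).memLp_two S m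
  mean_zero := integral_phaseMeasure_eq_zero_of_odd fun z => by
    rw [← polyFun_neg, ← hodd, polyFun_scaleHom]
    congr 1; ext <;> simp
  weak g hg hs := by
    have e := (SmoothGrowth.of_hasCompactSupport hg hs).integral_mul_signedGen_comm
      (smoothGrowth_polyFun ψ) hS hm (-1) γ
    rw [signedGen_neg_one, neg_neg, signedGen_one] at e
    rw [e, ← integral_neg]
    congr 1; ext z
    rw [← h]; ring

lemma isStrongPoissonSolution_polyFun {S m : ℝ≥0} {γ : ℝ} {f : ℝ → ℝ}
    {ψ : MvPolynomial (Fin 2) ℝ} (h : ∀ z, -langevinGen S m γ (polyFun ψ) z = centred S f z) :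
    IsStrongPoissonSolution S m γ f (polyFun ψ) := by
  obtain ⟨R, g, hR, hg, happ, hgen⟩ := (smoothGrowth_polyFun ψ).exists_approx S m 1 γ
  refine ⟨(polyGrowth_polyFun ψ).memLp_two S m, g, hg,
    tendsto_eLpNorm_of_le_one_div_mul hR happ, tendsto_eLpNorm_of_le_one_div_mul hR fun n z => ?_⟩
  have := hgen n z
  rw [signedGen_one, signedGen_one] at this
  rwa [← h, ← sub_eq_add_neg]

/-! ### Dependence on the friction -/

/-- For small `γ` the term `γ N v` is absorbed on the left, so `v` is bounded by twice `v₀`; then `l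
(v γ) = -γ l (N (v γ))`. -/
lemma isBigO_of_add_smul_eq {V : Type*} [AddCommGroup V] [Module ℝ V] [FiniteDimensional ℝ V]
    (N : V →ₗ[ℝ] V) {v₀ : V} {v : ℝ → V} (hv : ∀ γ, 0 < γ → v γ + γ • N (v γ) = v₀)
    {l : V →ₗ[ℝ] ℝ} (hl : l v₀ = 0) : (fun γ => l (v γ)) =O[𝓝[>] 0] fun γ : ℝ => γ := by
  -- `V` carries no norm; coordinates provide one, in which linear maps are bounded.
  let e := (Module.finBasis ℝ V).equivFun
  let N' := LinearMap.toContinuousLinearMap (e.toLinearMap ∘ₗ N ∘ₗ e.symm.toLinearMap)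
  let l' := LinearMap.toContinuousLinearMap (l ∘ₗ e.symm.toLinearMap)
  have hN' : ∀ x, N' (e x) = e (N x) := fun x => by simp [N']
  have hl' : ∀ x, l' (e x) = l x := fun x => by simp [l']
  have hδ : (0 : ℝ) < 1 / (2 * (‖N'‖ + 1)) := by positivity
  refine IsBigO.of_bound (‖l'‖ * (‖N'‖ * (2 * ‖e v₀‖))) ?_
  filter_upwards [Ioo_mem_nhdsGT hδ] with γ hγ
  obtain ⟨h0, h1⟩ := hγ
  have hev : e (v γ) = e v₀ - γ • N' (e (v γ)) := by
    rw [hN', ← map_smul, ← map_sub, ← hv γ h0, add_sub_cancel_right]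
  have hsmall : γ * ‖N'‖ ≤ 1 / 2 := by
    rw [lt_div_iff₀ (by positivity)] at h1
    nlinarith [norm_nonneg N']
  have hbound : ‖e (v γ)‖ ≤ 2 * ‖e v₀‖ := by
    have h2 : ‖e (v γ)‖ ≤ ‖e v₀‖ + γ * (‖N'‖ * ‖e (v γ)‖) := by
      conv_lhs => rw [hev]
      refine (norm_sub_le _ _).trans ?_
      rw [norm_smul, Real.norm_of_nonneg h0.le]
      gcongr
      exact N'.le_opNorm _
    nlinarith [norm_nonneg (e (v γ))]
  have hlv : l (v γ) = -(γ * l' (N' (e (v γ)))) := by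
    rw [hN', hl', ← smul_eq_mul, ← map_smul, ← map_neg, ← sub_eq_zero, ← map_sub, sub_neg_eq_add,
      hv γ h0, hl]
  rw [hlv, norm_neg, norm_mul, mul_comm]
  gcongr
  refine (l'.le_opNorm _).trans ?_
  gcongr
  refine (N'.le_opNorm _).trans ?_
  gcongr

/-! ### The odd observable -/

section Observable

open MvPolynomial

/-- The observable `oddPoly k a`, as a polynomial on phase space. -/
noncomputable def oddPolyMv (k : ℕ) (a : ℕ → ℝ) : MvPolynomial (Fin 2) ℝ :=
  ∑ i ∈ Finset.range (k + 1), a i • X 0 ^ (2 * i + 1)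

lemma polyFun_oddPolyMv (k : ℕ) (a : ℕ → ℝ) (z : ℝ × ℝ) :
    polyFun (oddPolyMv k a) z = oddPoly k a z.1 := by
  simp [polyFun, oddPolyMv, oddPoly]

lemma oddPolyMv_mem (k : ℕ) (a : ℕ → ℝ) : oddPolyMv k a ∈ oddPolySubmodule (2 * k + 1) := by
  refine Submodule.sum_mem _ fun i hi => Submodule.smul_mem _ _ (mem_oddPolySubmodule.2 ⟨?_, ?_⟩)
  · rw [totalDegree_X_pow]
    have := Finset.mem_range.1 hi
    omega
  · rw [map_pow, scaleHom_X, smul_pow, Odd.neg_one_pow ⟨i, rfl⟩, neg_one_smul]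

lemma scaleHom_momentum_oddPolyMv (k : ℕ) (a : ℕ → ℝ) :
    scaleHom ![1, -1] (oddPolyMv k a) = oddPolyMv k a := by
  apply polyFun_injective
  ext z
  simp [polyFun_scaleHom, polyFun_oddPolyMv]

lemma integral_oddPoly (S : ℝ≥0) (k : ℕ) (a : ℕ → ℝ) :
    ∫ q, oddPoly k a q ∂(gaussianReal 0 S) = 0 :=
  integral_eq_zero_of_odd fun x => by
    simp only [oddPoly, ← Finset.sum_neg_distrib]
    exact Finset.sum_congr rfl fun i _ => by rw [Odd.neg_pow ⟨i, rfl⟩]; ring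

lemma centred_oddPoly (S : ℝ≥0) (k : ℕ) (a : ℕ → ℝ) :
    centred S (oddPoly k a) = polyFun (oddPolyMv k a) := by
  ext z
  rw [centred, integral_oddPoly, sub_zero, polyFun_oddPolyMv]

/-- Fubini separates the only factor depending on the friction, the coefficient, from a fixed
product of moments. -/
lemma contribution_oddPoly (S m : ℝ≥0) (k : ℕ) (a : ℕ → ℝ) (ψ : MvPolynomial (Fin 2) ℝ)
    (d : Fin 2 →₀ ℕ) :
    contribution S m (oddPoly k a) ψ d = coeff d ψ *
      (2 * ((∫ q, q ^ d 0 * oddPoly k a q ∂(gaussianReal 0 S)) *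
        ∫ p, p ^ d 1 ∂(gaussianReal 0 m))) := by
  have e : ∀ z : ℝ × ℝ, polyFun (monomial d (coeff d ψ)) z * centred S (oddPoly k a) z
      = coeff d ψ * ((z.1 ^ d 0 * oddPoly k a z.1) * z.2 ^ d 1) := fun z => by
    rw [centred_oddPoly, polyFun_oddPolyMv]
    simp only [polyFun, eval_monomial, Finsupp.prod_fintype _ _ (fun i => pow_zero _),
      Fin.prod_univ_two]
    simp; ring
  rw [contribution, asympVar]
  simp_rw [e]
  rw [integral_const_mul, phaseMeasure,
    integral_prod_mul (fun q : ℝ => q ^ d 0 * oddPoly k a q) (fun p : ℝ => p ^ d 1)]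
  ring

end Observable

/-! ### Perturbation from the Hamiltonian limit and the main theorem -/

lemma oddGen_eq_add (S m : ℝ≥0) (γ : ℝ) (N : ℕ) (u : oddPolySubmodule N) :
    oddGen S m 1 γ N u = oddGen S m 1 0 N u + γ • oddGen S m 0 1 N u := by
  apply Subtype.ext
  change polyGen S m 1 γ u = polyGen S m 1 0 u + γ • polyGen S m 0 1 u
  apply polyFun_injective
  ext z
  simp only [polyFun_add, polyFun_smul, polyFun_polyGen, signedGen]
  ring

/-- The solution of the Poisson equation for the Hamiltonian dynamics is odd in the momentum. -/
lemma scaleHom_momentum_hamiltonian_solution {S m : ℝ≥0} (hS : S ≠ 0) (hm : m ≠ 0)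
    {ψ F : MvPolynomial (Fin 2) ℝ} (hodd : scaleHom (fun _ => -1) ψ = -ψ)
    (hF : scaleHom ![1, -1] F = F) (h : polyGen S m 1 0 ψ = -F) :
    scaleHom ![1, -1] ψ = -ψ := by
  rw [eq_neg_iff_add_eq_zero]
  -- The sum of `ψ` and its momentum reversal is still odd, and the Hamiltonian part sends it to `F
  -- - F = 0`.
  refine eq_zero_of_hamiltonian_eq_zero hS hm ?_ ?_
  · apply polyFun_injective
    ext z
    have h1 := fun w => congrArg (fun χ => polyFun χ w) hodd
    simp only [polyFun_scaleHom, polyFun_neg] at h1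
    have h2 := h1 z
    have h3 := h1 (z.1, -z.2)
    simp only [polyFun_scaleHom, polyFun_neg, polyFun_add, Matrix.cons_val_zero,
      Matrix.cons_val_one, one_mul, neg_mul, neg_neg] at h2 h3 ⊢
    rw [h2, h3]; ring
  · have hneg : polyGen S m (-1) 0 ψ = F := by
      apply polyFun_injective
      ext z
      have := congrArg (fun χ => polyFun χ z) h
      simp only [polyFun_neg, polyFun_polyGen, signedGen] at this ⊢
      linarith
    rw [map_add, polyGen_scaleHom_momentum, hneg, hF, h, add_neg_cancel]

theorem mainTheorem6 (S m : ℝ≥0) (hS : 0 < S) (hm : 0 < m) (k : ℕ) (a : ℕ → ℝ) :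
    -- the observable has mean zero under the target
    (∫ q, oddPoly k a q ∂(gaussianReal 0 S) = 0) ∧
    ∃ ψ : ℝ → MvPolynomial (Fin 2) ℝ,
      -- for each friction, the solution of the Poisson equation is a polynomial
      (∀ γ : ℝ, 0 < γ →
        (ψ γ).totalDegree ≤ 2 * k + 1 ∧
        (∀ z, -langevinGen S m γ (polyFun (ψ γ)) z = centred S (oddPoly k a) z) ∧
        IsPoissonSolution S m γ (oddPoly k a) (polyFun (ψ γ)) ∧
        IsStrongPoissonSolution S m γ (oddPoly k a) (polyFun (ψ γ)) ∧
        ∀ φ : ℝ × ℝ → ℝ, IsPoissonSolution S m γ (oddPoly k a) φ →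
          φ =ᵐ[phaseMeasure S m] polyFun (ψ γ)) ∧
      -- every contribution to the asymptotic variance is of order `γ`
      (∀ d : Fin 2 →₀ ℕ,
        (fun γ : ℝ => contribution S m (oddPoly k a) (ψ γ) d) =O[𝓝[>] 0] fun γ : ℝ => γ) ∧
      -- the asymptotic variance is of order `γ`, and its infimum over `γ > 0` is zero
      ∀ φ : ℝ → ℝ × ℝ → ℝ,
        (∀ γ : ℝ, 0 < γ → IsPoissonSolution S m γ (oddPoly k a) (φ γ)) →
        ((fun γ : ℝ => asympVar S m (oddPoly k a) (φ γ)) =O[𝓝[>] 0] fun γ : ℝ => γ) ∧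
        IsGLB ((fun γ : ℝ => asympVar S m (oddPoly k a) (φ γ)) '' Set.Ioi 0) 0 := by
  have hS' := hS.ne'
  have hm' := hm.ne'
  refine ⟨integral_oddPoly S k a, ?_⟩
  let F : oddPolySubmodule (2 * k + 1) := ⟨oddPolyMv k a, oddPolyMv_mem k a⟩
  -- `γ = 0` is included as the base point of the perturbation; for negative `γ` the value is an
  -- irrelevant default.
  have hex : ∀ γ : ℝ, ∃ u, 0 ≤ γ → oddGen S m 1 γ (2 * k + 1) u = -F := fun γ => by
    by_cases hγ : 0 ≤ γ
    · obtain ⟨u, hu⟩ := (oddGen_bijective hS' hm' hγ (2 * k + 1)).2 (-F)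
      exact ⟨u, fun _ => hu⟩
    · exact ⟨0, fun h => absurd h hγ⟩
  choose u hu using hex
  have hgen : ∀ γ : ℝ, 0 ≤ γ → polyGen S m 1 γ (u γ) = -oddPolyMv k a := fun γ hγ =>
    congrArg Subtype.val (hu γ hγ)
  have hodd : ∀ γ : ℝ, scaleHom (fun _ => -1) (u γ : MvPolynomial (Fin 2) ℝ) = -(u γ) := fun γ =>
    (mem_oddPolySubmodule.1 (u γ).2).2
  have hpt : ∀ γ : ℝ, 0 ≤ γ → ∀ z,
      -langevinGen S m γ (polyFun (u γ)) z = centred S (oddPoly k a) z := fun γ hγ z => by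
    rw [← signedGen_one, ← polyFun_polyGen, hgen γ hγ, polyFun_neg, neg_neg, centred_oddPoly]
  have hsol : ∀ γ : ℝ, 0 ≤ γ → IsPoissonSolution S m γ (oddPoly k a) (polyFun (u γ)) :=
    fun γ hγ => isPoissonSolution_polyFun hS' hm' (hodd γ) (hpt γ hγ)
  let A := LinearEquiv.ofBijective _ (oddGen_bijective hS' hm' le_rfl (2 * k + 1))
  -- The Poisson equation multiplied by the inverse of the Hamiltonian part.
  have hfric : ∀ γ : ℝ, 0 < γ →
      u γ + γ • (A.symm.toLinearMap ∘ₗ oddGen S m 0 1 (2 * k + 1)) (u γ) = u 0 := fun γ hγ => by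
    apply A.injective
    have hA : ∀ x, A x = oddGen S m 1 0 (2 * k + 1) x := fun x => rfl
    rw [map_add, map_smul, LinearMap.comp_apply, LinearEquiv.coe_coe, A.apply_symm_apply, hA, hA,
      hu 0 le_rfl, ← oddGen_eq_add, hu γ hγ.le]
  have hu0 := scaleHom_momentum_hamiltonian_solution hS' hm' (hodd 0)
    (scaleHom_momentum_oddPolyMv k a) (hgen 0 le_rfl)
  have henergy : ∀ γ : ℝ, 0 ≤ γ → asympVar S m (oddPoly k a) (polyFun (u γ))
      = 2 * (γ * ∫ z, dp (polyFun (u γ)) z ^ 2 ∂(phaseMeasure S m)) := fun γ hγ => by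
    have e := (smoothGrowth_polyFun (u γ)).integral_self_mul_signedGen hS' hm' 1 γ
    rw [signedGen_one] at e
    rw [asympVar]
    simp_rw [← hpt γ hγ, mul_neg]
    rw [integral_neg, e, neg_neg]
  refine ⟨fun γ => u γ, fun γ hγ => ⟨(mem_oddPolySubmodule.1 (u γ).2).1, hpt γ hγ.le, hsol γ hγ.le,
    isStrongPoissonSolution_polyFun (hpt γ hγ.le), fun φ hφ => hφ.ae_eq hS' hm' hγ (hsol γ hγ.le)⟩,
    fun d => ?_, fun φ hφ => ?_⟩
  · simp only [contribution_oddPoly]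
    -- For an even power of `p` the coefficient of `u 0` vanishes by oddness in the momentum; for an
    -- odd power the Gaussian moment vanishes for every `γ`.
    rcases Nat.even_or_odd (d 1) with hd | hd
    · refine IsBigO.trans ?_ (isBigO_of_add_smul_eq _ hfric
        (l := MvPolynomial.lcoeff ℝ d ∘ₗ Submodule.subtype _) ?_)
      · simp_rw [mul_comm (MvPolynomial.coeff d _)]
        exact isBigO_const_mul_self _ _ _
      · have h := congrArg (MvPolynomial.coeff d) hu0
        rw [coeff_scaleHom] at h
        simp only [Matrix.cons_val_zero, Matrix.cons_val_one, one_pow, hd.neg_one_pow, one_mul,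
          MvPolynomial.coeff_neg] at h
        change MvPolynomial.coeff d (u 0 : MvPolynomial (Fin 2) ℝ) = 0
        linarith
    · rw [integral_eq_zero_of_odd (f := fun p : ℝ => p ^ d 1) (fun p => hd.neg_pow p)]
      simpa using isBigO_zero _ _
  · have hvar : ∀ γ : ℝ, 0 < γ → asympVar S m (oddPoly k a) (φ γ)
        = asympVar S m (oddPoly k a) (polyFun (u γ)) := fun γ hγ => by
      rw [asympVar, asympVar]
      congr 1
      refine integral_congr_ae ?_
      filter_upwards [(hφ γ hγ).ae_eq hS' hm' hγ (hsol γ hγ.le)] with z hz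
      rw [hz]
    have hprod : ∀ χ : oddPolySubmodule (2 * k + 1), Integrable
        (fun z => polyFun χ z * centred S (oddPoly k a) z) (phaseMeasure S m) := fun χ => by
      rw [centred_oddPoly]
      exact ((polyGrowth_polyFun _).mul (polyGrowth_polyFun _)).integrable S m
    let l : oddPolySubmodule (2 * k + 1) →ₗ[ℝ] ℝ :=
      { toFun := fun χ => asympVar S m (oddPoly k a) (polyFun χ)
        map_add' := fun χ₁ χ₂ => by
          simp only [asympVar, Submodule.coe_add, polyFun_add, add_mul]
          rw [integral_add (hprod χ₁) (hprod χ₂), mul_add]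
        map_smul' := fun c χ => by
          simp only [asympVar, Submodule.coe_smul, polyFun_smul, mul_assoc, integral_const_mul,
            RingHom.id_apply, smul_eq_mul]
          ring }
    have hl : l (u 0) = 0 := by
      change asympVar S m (oddPoly k a) (polyFun (u 0)) = 0
      rw [henergy 0 le_rfl, zero_mul, mul_zero]
    have hO : (fun γ : ℝ => asympVar S m (oddPoly k a) (φ γ)) =O[𝓝[>] 0] fun γ : ℝ => γ := by
      refine (isBigO_of_add_smul_eq _ hfric hl).congr' ?_ EventuallyEq.rfl
      filter_upwards [self_mem_nhdsWithin] with γ hγ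
      exact (hvar γ hγ).symm
    refine ⟨hO, ?_, fun b hb => ?_⟩
    · rintro _ ⟨γ, hγ, rfl⟩
      have hγ0 : 0 < γ := hγ
      simp only
      rw [hvar γ hγ, henergy γ hγ0.le]
      have : 0 ≤ ∫ z, dp (polyFun (u γ)) z ^ 2 ∂(phaseMeasure S m) :=
        integral_nonneg fun z => sq_nonneg _
      positivity
    -- The variance tends to `0` as `γ → 0`, so no lower bound exceeds `0`.
    · have ht := hO.trans_tendsto (tendsto_id.mono_left nhdsWithin_le_nhds)
      refine ge_of_tendsto ht ?_
      filter_upwards [self_mem_nhdsWithin] with γ hγ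
      exact hb ⟨γ, hγ, rfl⟩
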